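/- **Setting.** $\mathbf C$ is an adhesive category (with pullbacks) that has a strict initial object, in which every morphism factors as an epimorphism followed by a monomorphism, and in which every object has finitely many subobjects. A *linear rule* is a span of monomorphisms $r=(O\xleftarrow{o}K\xrightarrow{i}I)$. A *direct derivation* $X\Rightarrow Y$ of type $T\in\{DPO,SqPO\}$ along $r$ at a monomorphism $m:I\to X$ consists of $K\to\overline K\to X$, which completes $K\to I\to X$ to a pushout (DPO), respectively is its final pullback complement (SqPO), and of the pushout $Y$ of $O\leftarrow K\to\overline K$; $O\to Y$ is the comatch, and $m$ is called $T$-admissible if such a derivation exists. $DPO^\dagger$ is DPO read from $Y$ to $X$. *Conditions* $c_X$ over an object $X$ are built from $\mathrm{true}$, $\exists(a:X\to A,c_A)$ with $a$ mono, negation and conjunctions; a mono $m:X\to Y$ satisfies $\exists(a,c_A)$ if $m=q\circ a$ for a mono $q:A\to Y$ with $q\vDash c_A$; $c\equiv c'$ means that the same monos satisfy $c$ and $c'$. A *rule with condition* is $R=(r,c_I)$. A span of monos $\mu_{21}=(I_2\leftarrow M_{21}\to O_1)$ is a $T$-admissible match of $r_2$ into $r_1$ if, with $N_{21}$ the pushout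 of $\mu_{21}$, $I_2\to N_{21}$ is $T$-admissible for $r_2$ and $O_1\to N_{21}$ is $DPO^\dagger$-admissible for $r_1$. Let $O_{21}\leftarrow\overline K_2\to N_{21}$ and $N_{21}\leftarrow\overline K_1\to I_{21}$ be the bottom rows of the two derivations; the composite rule $r_2\lhd^{T}_{\mu_{21}} r_1=(O_{21}\leftarrow K_{21}\to I_{21})$ is their pullback composition, with condition $c_{I_{21}}=\mathsf{Shift}(I_1\to I_{21},c_{I_1})\wedge\mathsf{Trans}(N_{21}\Leftarrow I_{21},\mathsf{Shift}(I_2\to N_{21},c_{I_2}))$, where $\mathsf{Shift}$ and $\mathsf{Trans}$ are the usual shift of a condition along a mono and transport of a condition from the output to the input of a rule. It is a $T$-admissible match of $R_2$ into $R_1$ if moreover $c_{I_{21}}\not\equiv\mathrm{false}$. The rules $r_1,r_2$ are *sequentially independent with respect to* $\mu_{21}$ if there are monos $O_1\to\overline K_2$ and $I_2\to\overline K_1$ through which $O_1\to N_{21}$ and $I_2\to N_{21}$ factor. Two consecutive derivations $X_0\Rightarrow X_1\Rightarrow X_2$ of $r_1$ and then $r_2$, with matches $m_1,m_2$ and intermediate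 objects $K_1',K_2'$, have *overlap* $\mu$ if $\mu$ is the pullback of $I_2\to X_1\leftarrow O_1$. They are *sequentially independent* if $O_1\to X_1$ factors through $K_2'$ and $I_2\to X_1$ through $K_1'$ by monos. For rules with conditions one asks in addition that $r_2$ can be applied at $I_2\to K_1'\to X_0$, that $m_1$ factors through the intermediate object of this application, that $r_1$ can be applied at the resulting match and leads to $X_2$, and that these two matches satisfy $c_{I_2}$ and $c_{I_1}$. For spans $\mu_{21},\mu_{12}$, the rules with conditions $R_1,R_2$ are *$T$-sequentially independent* if all $T$-derivation pairs of $R_1$ followed by $R_2$ with overlap $\mu_{21}$, and of $R_2$ followed by $R_1$ with overlap $\mu_{12}$, whose matches satisfy the conditions, are sequentially independent in this sense. **Theorem (Compositional concurrent commutativity).** Let $R_1,R_2$ be rules with conditions and let $\mu_{21}=(I_2\leftarrow M_{21}\to O_1)$ be a $T$-admissible match of $R_2$ into $R_1$, $T\in\{DPO,SqPO\}$. Suppose that $O_1\to N_{21}$ and $I_2\to N_{21}$ factor through monomorphisms $O_1\to\overline K_2$ and $I_2\to\overline K_1$. Then: (i) The pullbacks $M_{21}'$ of $I_2\to\overline K_1\leftarrow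 K_1$ and $M_{21}''$ of $K_2\to\overline K_2\leftarrow O_1$ are isomorphic to $M_{21}$, compatibly with the maps to $I_2$ and $O_1$; this yields monomorphisms $a_1:M_{21}\to K_1$ and $a_2:M_{21}\to K_2$ with $o_1 a_1=(M_{21}\to O_1)$ and $i_2a_2=(M_{21}\to I_2)$. (ii) $\mu_{12}:=(I_1\xleftarrow{i_1 a_1}M_{21}\xrightarrow{o_2 a_2}O_2)$ is a DPO-admissible and an SqPO-admissible match of $r_1$ into $r_2$. (iii) In both types of rewriting, $r_1$ and $r_2$ are sequentially independent with respect to $\mu_{12}$, and all derivations of $r_2$ followed by $r_1$ with overlap $\mu_{12}$ are sequentially independent. The span $\mu_{21}$ is DPO- and SqPO-admissible, and $$ r_2\lhd^{SqPO}_{\mu_{21}}r_1\;\cong\; r_2\lhd^{DPO}_{\mu_{21}}r_1\;\cong\; r_1\lhd^{DPO}_{\mu_{12}}r_2\;\cong\; r_1\lhd^{SqPO}_{\mu_{12}}r_2 .$$ Moreover, for each type, the composites along $\mu_{21}$ and $\mu_{12}$ are isomorphic compatibly with the embeddings of $I_1$ and $I_2$ into $I_{21}$ and $I_{12}$. (iv)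 For each type, the rules with conditions $R_1,R_2$ are sequentially independent (with respect to $\mu_{21},\mu_{12}$) only if $c_{I_{21}}$ and $c_{I_{12}}$ agree along this isomorphism $I_{21}\cong I_{12}$ up to admissibility. For $DPO$: every DPO-admissible match $m:I_{21}\to X$ of the composite rule satisfies both or neither. For $SqPO$: every mono $m:I_{21}\to X$ for which $I_1\to I_{21}\to X$ and $I_2\to I_{21}\to X$ are SqPO-admissible for $r_1$ and $r_2$ satisfies both or neither; in particular, $c_{I_{21}}\equiv c_{I_{12}}$ if composable pairs of monos in $\mathbf C$ have final pullback complements. -/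

import Mathlib

open CategoryTheory CategoryTheory.Limits

universe u v

namespace Rewriting

section Ambient

variable (C : Type u) [Category.{v} C]

/-- Every morphism is an epimorphism followed by a monomorphism. -/
def HasEpiMonoFactorization : Prop :=
  ∀ ⦃X Y : C⦄ (f : X ⟶ Y), ∃ (E : C) (e : X ⟶ E) (m : E ⟶ Y), Epi e ∧ Mono m ∧ e ≫ m = f

/-- Every object has only finitely many subobjects. -/
def IsFinitary : Prop := ∀ X : C, Finite (Subobject X)

end Ambient

variable {C : Type u} [Category.{v} C]

/-! ### Spans, rules, final pullback complements, direct derivations -/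

/-- A span of monomorphisms `A ← M → B`. -/
structure MonoSpan (A B : C) where
  M : C
  left : M ⟶ A
  right : M ⟶ B
  mono_left : Mono left
  mono_right : Mono right

/-- A linear rule `O ← K → I`: a span of monomorphisms from the input `I` to the output `O`. -/
structure LinearRule (C : Type u) [Category.{v} C] where
  O : C
  K : C
  I : C
  o : K ⟶ O
  i : K ⟶ I
  mono_o : Mono o
  mono_i : Mono i

/-- Isomorphisms of linear rules. -/
structure LinearRule.Iso (r s : LinearRule C) where
  isoO : r.O ≅ s.O
  isoK : r.K ≅ s.K
  isoI : r.I ≅ s.I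
  comm_o : r.o ≫ isoO.hom = isoK.hom ≫ s.o
  comm_i : r.i ≫ isoI.hom = isoK.hom ≫ s.i

/-- `K --b--> D --d--> X` is a final pullback complement of `K --a--> I --c--> X`. -/
structure IsFinalPullbackComplement {K I X D : C}
    (a : K ⟶ I) (c : I ⟶ X) (b : K ⟶ D) (d : D ⟶ X) : Prop where
  isPullback : IsPullback a b c d
  final : ∀ ⦃P Z : C⦄ (x : P ⟶ I) (y : P ⟶ Z) (z : Z ⟶ X), IsPullback x y c z →
    ∀ w : P ⟶ K, w ≫ a = x → ∃! w' : Z ⟶ D, w' ≫ d = z ∧ y ≫ w' = w ≫ b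

/-- Every composable pair of monomorphisms has a final pullback complement. -/
def HasFinalPullbackComplements (C : Type u) [Category.{v} C] : Prop :=
  ∀ ⦃K I X : C⦄ (a : K ⟶ I) (c : I ⟶ X), Mono a → Mono c →
    ∃ (D : C) (b : K ⟶ D) (d : D ⟶ X), IsFinalPullbackComplement a c b d

/-- The two types of rewriting. -/
inductive RewritingType
  | DPO
  | SqPO

/-- `K --b--> D --d--> X` is a complement of `K --a--> I --c--> X` of the given type:
a pushout complement for DPO, a final pullback complement for SqPO. -/
def RewritingType.IsComplement (T : RewritingType) {K I X D : C}
    (a : K ⟶ I) (c : I ⟶ X) (b : K ⟶ D) (d : D ⟶ X) : Prop :=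
  match T with
  | .DPO => IsPushout a b c d
  | .SqPO => IsFinalPullbackComplement a c b d

/-- A direct derivation of type `T` from `X` to `Y` along the rule `r`:
```
  O  <--o--  K  --i-->  I
  |          |          |
comatch      k       inMatch
  v          v          v
  Y  <--d'-- D  --d-->  X
```
The right square is a complement of type `T`, the left square a pushout. For `T = DPO` both
squares are pushouts, so that a DPO derivation from `X` to `Y` is the same diagram as a
derivation of the opposite type `DPO†` from `Y` to `X` along the comatch. -/
structure DirectDerivation (T : RewritingType) (r : LinearRule C) (X Y : C) where
  inMatch : r.I ⟶ X
  comatch : r.O ⟶ Y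
  D : C
  k : r.K ⟶ D
  d : D ⟶ X
  d' : D ⟶ Y
  mono_inMatch : Mono inMatch
  isComplement : T.IsComplement r.i inMatch k d
  isPushout : IsPushout r.o k comatch d'

/-- `m : I → X` is a `T`-admissible match of the rule `r` into the object `X`. -/
def IsAdmissibleMatch (T : RewritingType) (r : LinearRule C) {X : C} (m : r.I ⟶ X) : Prop :=
  ∃ (Y : C) (δ : DirectDerivation T r X Y), δ.inMatch = m

theorem IsFinalPullbackComplement.mono [HasPullbacks C] {K I X D : C} {a : K ⟶ I} {c : I ⟶ X}
    {b : K ⟶ D} {d : D ⟶ X} [Mono a] (h : IsFinalPullbackComplement a c b d) : Mono d := by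
  constructor
  intro Z f g hfg
  have hP := IsPullback.of_hasPullback c (f ≫ d)
  have hwf : pullback.fst c (f ≫ d) ≫ c = (pullback.snd c (f ≫ d) ≫ f) ≫ d := by
    simp [pullback.condition]
  have hwg : pullback.fst c (f ≫ d) ≫ c = (pullback.snd c (f ≫ d) ≫ g) ≫ d := by
    simp [pullback.condition, hfg]
  have e : h.isPullback.lift _ _ hwf = h.isPullback.lift _ _ hwg := by
    rw [← cancel_mono a]; simp
  obtain ⟨w', -, hu⟩ := h.final _ _ _ hP (h.isPullback.lift _ _ hwf) (by simp)
  rw [hu f ⟨rfl, by simp⟩, hu g ⟨hfg.symm, by rw [e]; simp⟩]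

theorem DirectDerivation.mono_d [HasPullbacks C] [Adhesive C] {T : RewritingType}
    {r : LinearRule C} {X Y : C} (δ : DirectDerivation T r X Y) : Mono δ.d := by
  have := r.mono_i
  cases T with
  | DPO =>
    have h : IsPushout r.i δ.k δ.inMatch δ.d := δ.isComplement
    exact Adhesive.mono_of_isPushout_of_mono_left h
  | SqPO =>
    have h : IsFinalPullbackComplement r.i δ.inMatch δ.k δ.d := δ.isComplement
    exact h.mono

theorem DirectDerivation.mono_d' [Adhesive C] {T : RewritingType}
    {r : LinearRule C} {X Y : C} (δ : DirectDerivation T r X Y) : Mono δ.d' :=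
  have := r.mono_o
  Adhesive.mono_of_isPushout_of_mono_left δ.isPushout

/-! ### Conditions -/

/-- Conditions over the objects of `C`. Conjunctions range over arbitrary (small) index types. -/
inductive Condition {C : Type u} [Category.{v} C] : C → Type (max u v + 1)
  | tt {X : C} : Condition X
  | ex {X A : C} (a : X ⟶ A) (ha : Mono a) (c : Condition A) : Condition X
  | neg {X : C} (c : Condition X) : Condition X
  | conj {X : C} (ι : Type (max u v)) (c : ι → Condition X) : Condition X

namespace Condition

/-- The condition `false`. -/
def ff {X : C} : Condition X := neg tt

/-- Binary conjunction. -/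
def and {X : C} (c c' : Condition X) : Condition X :=
  conj (ULift Bool) fun b => bif b.down then c else c'

/-- Disjunction. -/
def disj {X : C} (ι : Type (max u v)) (c : ι → Condition X) : Condition X :=
  neg (conj ι fun j => neg (c j))

/-- Satisfaction `m ⊨ c` (used for monomorphisms `m`). -/
def Sat : {X : C} → Condition X → {Y : C} → (X ⟶ Y) → Prop
  | _, tt, _, _ => True
  | _, ex (A := A) a _ c, Y, m => ∃ q : A ⟶ Y, Mono q ∧ a ≫ q = m ∧ Sat c q
  | _, neg c, _, m => ¬ Sat c m
  | _, conj _ c, _, m => ∀ j, Sat (c j) m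

/-- Equivalence of conditions over the same object. -/
def Equiv {X : C} (c c' : Condition X) : Prop :=
  ∀ ⦃Y : C⦄ (m : X ⟶ Y), Mono m → (c.Sat m ↔ c'.Sat m)

/-- Conditions `c` over `A` and `c'` over `B` agree, along the isomorphism `e : A ≅ B`, on all
monomorphisms `m : A → X` for which `P m` holds. -/
def EquivAlong {A B : C} (e : A ≅ B) (P : ∀ ⦃X : C⦄, (A ⟶ X) → Prop)
    (c : Condition A) (c' : Condition B) : Prop :=
  ∀ ⦃X : C⦄ (m : A ⟶ X), Mono m → P m → (c.Sat m ↔ c'.Sat (e.inv ≫ m))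

/-- Spans of monomorphisms `B₁ ← F → B₂` under `a₁ : A → B₁` and `a₂ : A → B₂`. -/
structure ShiftSpan {A B₁ B₂ : C} (a₁ : A ⟶ B₁) (a₂ : A ⟶ B₂) where
  F : C
  b₁ : F ⟶ B₁
  b₂ : F ⟶ B₂
  f : A ⟶ F
  mono_b₁ : Mono b₁
  mono_b₂ : Mono b₂
  fac₁ : f ≫ b₁ = a₁
  fac₂ : f ≫ b₂ = a₂

/-- Isomorphism of spans. -/
def shiftSetoid {A B₁ B₂ : C} (a₁ : A ⟶ B₁) (a₂ : A ⟶ B₂) : Setoid (ShiftSpan a₁ a₂) where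
  r s t := ∃ e : s.F ≅ t.F, e.hom ≫ t.b₁ = s.b₁ ∧ e.hom ≫ t.b₂ = s.b₂
  iseqv :=
    { refl := fun s => ⟨Iso.refl _, by simp⟩
      symm := by
        rintro s t ⟨e, h₁, h₂⟩
        exact ⟨e.symm, by simp [← h₁], by simp [← h₂]⟩
      trans := by
        rintro s t w ⟨e, h₁, h₂⟩ ⟨e', h₁', h₂'⟩
        exact ⟨e ≪≫ e', by simp [h₁, h₁'], by simp [h₂, h₂']⟩ }

/-- The set of isomorphism classes of spans over which the shift of an existential ranges. -/
def ShiftIndex {A B₁ B₂ : C} (a₁ : A ⟶ B₁) (a₂ : A ⟶ B₂) : Type (max u v) :=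
  Quotient (shiftSetoid a₁ a₂)

/-- A representative of an isomorphism class of spans. -/
noncomputable def ShiftIndex.rep {A B₁ B₂ : C} {a₁ : A ⟶ B₁} {a₂ : A ⟶ B₂}
    (s : ShiftIndex a₁ a₂) : ShiftSpan a₁ a₂ := Quotient.out s

theorem ShiftSpan.hasPushout [Adhesive C] {A B₁ B₂ : C} {a₁ : A ⟶ B₁} {a₂ : A ⟶ B₂}
    (s : ShiftSpan a₁ a₂) : HasPushout s.b₁ s.b₂ :=
  have := s.mono_b₁
  inferInstance

/-- The pushout object `E` of a span. -/
noncomputable def ShiftSpan.E [Adhesive C] {A B₁ B₂ : C} {a₁ : A ⟶ B₁} {a₂ : A ⟶ B₂}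
    (s : ShiftSpan a₁ a₂) : C :=
  have := s.hasPushout
  pushout s.b₁ s.b₂

/-- The pushout leg `e₁ : B₁ → E`. -/
noncomputable def ShiftSpan.e₁ [Adhesive C] {A B₁ B₂ : C} {a₁ : A ⟶ B₁} {a₂ : A ⟶ B₂}
    (s : ShiftSpan a₁ a₂) : B₁ ⟶ s.E :=
  have := s.hasPushout
  pushout.inl s.b₁ s.b₂

/-- The pushout leg `e₂ : B₂ → E`. -/
noncomputable def ShiftSpan.e₂ [Adhesive C] {A B₁ B₂ : C} {a₁ : A ⟶ B₁} {a₂ : A ⟶ B₂}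
    (s : ShiftSpan a₁ a₂) : B₂ ⟶ s.E :=
  have := s.hasPushout
  pushout.inr s.b₁ s.b₂

theorem ShiftSpan.mono_e₁ [Adhesive C] {A B₁ B₂ : C} {a₁ : A ⟶ B₁} {a₂ : A ⟶ B₂}
    (s : ShiftSpan a₁ a₂) : Mono s.e₁ :=
  have := s.hasPushout
  have := s.mono_b₂
  Adhesive.mono_of_isPushout_of_mono_right (IsPushout.of_hasPushout s.b₁ s.b₂)

/-- `Shift(a₁, c)`: the shift of a condition over `A` along `a₁ : A → B₁`. -/
noncomputable def shift [Adhesive C] : {A : C} → Condition A → {B₁ : C} → (A ⟶ B₁) → Condition B₁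
  | _, tt, _, _ => tt
  | _, ex a₂ _ c, _, a₁ =>
      disj (ShiftIndex a₁ a₂) fun s => ex s.rep.e₁ s.rep.mono_e₁ (shift c s.rep.e₂)
  | _, neg c, _, a₁ => neg (shift c a₁)
  | _, conj ι c, _, a₁ => conj ι fun j => shift (c j) a₁

/-- A pushout complement of `K --o--> O --b--> B`. -/
structure POC {K O B : C} (o : K ⟶ O) (b : O ⟶ B) where
  D : C
  k : K ⟶ D
  d : D ⟶ B
  isPushout : IsPushout o k b d

theorem POC.mono_k {K O B : C} {o : K ⟶ O} {b : O ⟶ B} (p : POC o b) (ho : Mono o)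
    (hb : Mono b) : Mono p.k := by
  have : Mono (p.k ≫ p.d) := by rw [← p.isPushout.w]; exact mono_comp o b
  exact mono_of_mono p.k p.d

theorem POC.mono_d [Adhesive C] {K O B : C} {o : K ⟶ O} {b : O ⟶ B} (p : POC o b)
    (ho : Mono o) : Mono p.d :=
  Adhesive.mono_of_isPushout_of_mono_left p.isPushout

theorem hasPushout_of_mono [Adhesive C] {K I D : C} (i : K ⟶ I) (hi : Mono i) (k : K ⟶ D) :
    HasPushout i k := inferInstance

/-- The pushout object `B'` of `I <--i-- K --k--> D`. -/
noncomputable def pushoutObj [Adhesive C] {K I D : C} (i : K ⟶ I) (hi : Mono i) (k : K ⟶ D) : C :=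
  have := hasPushout_of_mono i hi k
  pushout i k

/-- The pushout leg `I → B'`. -/
noncomputable def pushoutInl [Adhesive C] {K I D : C} (i : K ⟶ I) (hi : Mono i) (k : K ⟶ D) :
    I ⟶ pushoutObj i hi k :=
  have := hasPushout_of_mono i hi k
  pushout.inl i k

/-- The pushout leg `D → B'`. -/
noncomputable def pushoutInr [Adhesive C] {K I D : C} (i : K ⟶ I) (hi : Mono i) (k : K ⟶ D) :
    D ⟶ pushoutObj i hi k :=
  have := hasPushout_of_mono i hi k
  pushout.inr i k

theorem mono_pushoutInl [Adhesive C] {K I D : C} (i : K ⟶ I) (hi : Mono i) (k : K ⟶ D)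
    (hk : Mono k) : Mono (pushoutInl i hi k) :=
  have := hasPushout_of_mono i hi k
  Adhesive.mono_of_isPushout_of_mono_right (IsPushout.of_hasPushout i k)

theorem mono_pushoutInr [Adhesive C] {K I D : C} (i : K ⟶ I) (hi : Mono i) (k : K ⟶ D) :
    Mono (pushoutInr i hi k) :=
  have := hasPushout_of_mono i hi k
  Adhesive.mono_of_isPushout_of_mono_left (IsPushout.of_hasPushout i k)

open Classical in
/-- `Trans(O ← K → I, c)`: the transport of a condition over the output `O` of a rule to its
input `I`. An existential along `b : O → B` becomes `false` unless `b` is a `DPO†`-admissible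
match, i.e. unless `K → O → B` has a pushout complement `K → D → B`; otherwise the existential
along `I → B'` is taken, with `B'` the pushout of `I ← K → D`, and the inner condition is
transported along the rule `B ← D → B'`. -/
noncomputable def trans [Adhesive C] : {O : C} → Condition O → {K I : C} → (o : K ⟶ O) →
    Mono o → (i : K ⟶ I) → Mono i → Condition I
  | _, tt, _, _, _, _, _, _ => tt
  | _, ex b hb c, _, _, o, ho, i, hi =>
      if h : Nonempty (POC o b) then
        ex (pushoutInl i hi h.some.k) (mono_pushoutInl i hi h.some.k (h.some.mono_k ho hb))
          (trans c h.some.d (h.some.mono_d ho)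
            (pushoutInr i hi h.some.k) (mono_pushoutInr i hi h.some.k))
      else ff
  | _, neg c, _, _, o, ho, i, hi => neg (trans c o ho i hi)
  | _, conj ι c, _, _, o, ho, i, hi => conj ι fun j => trans (c j) o ho i hi

end Condition

/-- A linear rule with a condition over its input. -/
structure ConditionalRule (C : Type u) [Category.{v} C] where
  rule : LinearRule C
  cond : Condition rule.I

/-! ### Composition of rules -/

/-- The diagram of the composition of type `T` of `r₂` with `r₁` along `μ = (I₂ ← M → O₁)`:
```
   O₂  <--  K₂  -->  I₂ <- M -> O₁ <--  K₁  -->  I₁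
   |        |          \       /        |        |
   O₂₁ <--  δ₂.D  -->     N      <--  δ₁.D  -->  I₂₁
```
`N` is the pushout of `μ`, the left part is a derivation of type `T` from `N` along `r₂`, the
right part a derivation of type `DPO†` from `N` along `r₁`, and `K₂₁` is the pullback of
`δ₂.D → N ← δ₁.D`. The objects `δ₂.D` and `δ₁.D` are the intermediate objects `K̄₂` and `K̄₁`. -/
structure Composition (T : RewritingType) (r₂ r₁ : LinearRule C) (μ : MonoSpan r₂.I r₁.O) where
  N : C
  O₂₁ : C
  I₂₁ : C
  δ₂ : DirectDerivation T r₂ N O₂₁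
  δ₁ : DirectDerivation .DPO r₁ I₂₁ N
  isPushout : IsPushout μ.left μ.right δ₂.inMatch δ₁.comatch
  K₂₁ : C
  p₂ : K₂₁ ⟶ δ₂.D
  p₁ : K₂₁ ⟶ δ₁.D
  isPullback : IsPullback p₂ p₁ δ₂.d δ₁.d'

/-- `μ` is a `T`-admissible match of the linear rule `r₂` into the linear rule `r₁`. -/
def IsAdmissibleRuleMatch (T : RewritingType) (r₂ r₁ : LinearRule C)
    (μ : MonoSpan r₂.I r₁.O) : Prop :=
  Nonempty (Composition T r₂ r₁ μ)

namespace Composition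

variable {T : RewritingType} {r₂ r₁ : LinearRule C} {μ : MonoSpan r₂.I r₁.O}

/-- The composite rule `O₂₁ ← K₂₁ → I₂₁`. -/
def composite [HasPullbacks C] [Adhesive C] (D : Composition T r₂ r₁ μ) : LinearRule C where
  O := D.O₂₁
  K := D.K₂₁
  I := D.I₂₁
  o := D.p₂ ≫ D.δ₂.d'
  i := D.p₁ ≫ D.δ₁.d
  mono_o := by
    have := D.δ₂.mono_d'
    have := D.δ₁.mono_d'
    have : Mono D.p₂ := ⟨fun f g h => D.isPullback.hom_ext h (by
      rw [← cancel_mono D.δ₁.d']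
      simp only [Category.assoc, ← D.isPullback.w]
      simp only [← Category.assoc, h])⟩
    exact mono_comp _ _
  mono_i := by
    have := D.δ₂.mono_d
    have := D.δ₁.mono_d
    have : Mono D.p₁ := ⟨fun f g h => D.isPullback.hom_ext (by
      rw [← cancel_mono D.δ₂.d]
      simp only [Category.assoc, D.isPullback.w]
      simp only [← Category.assoc, h]) h⟩
    exact mono_comp _ _

/-- The condition `c_{I₂₁} = Shift(I₁ → I₂₁, c₁) ∧ Trans(N ⇐ I₂₁, Shift(I₂ → N, c₂))` over the
input of the composite rule. -/
noncomputable def condition [HasPullbacks C] [Adhesive C] (D : Composition T r₂ r₁ μ)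
    (c₂ : Condition r₂.I) (c₁ : Condition r₁.I) : Condition D.I₂₁ :=
  (c₁.shift D.δ₁.inMatch).and
    ((c₂.shift D.δ₂.inMatch).trans D.δ₁.d' D.δ₁.mono_d' D.δ₁.d D.δ₁.mono_d)

/-- The monomorphisms `u : O₁ → K̄₂` and `v : I₂ → K̄₁` exhibit the two rules as sequentially
independent with respect to `μ`: they factor `O₁ → N` and `I₂ → N`. -/
structure IsIndependence (D : Composition T r₂ r₁ μ) (u : r₁.O ⟶ D.δ₂.D) (v : r₂.I ⟶ D.δ₁.D) :
    Prop where
  mono_u : Mono u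
  mono_v : Mono v
  fac_u : u ≫ D.δ₂.d = D.δ₁.comatch
  fac_v : v ≫ D.δ₁.d' = D.δ₂.inMatch

/-- The two linear rules are sequentially independent with respect to `μ`. -/
def SeqIndependent (D : Composition T r₂ r₁ μ) : Prop := ∃ u v, D.IsIndependence u v

end Composition

/-- The span `I₁ <--a₁ ≫ i₁-- M --a₂ ≫ o₂--> O₂`. -/
def switchSpan {r₂ r₁ : LinearRule C} {M : C} (a₁ : M ⟶ r₁.K) (a₂ : M ⟶ r₂.K) (h₁ : Mono a₁)
    (h₂ : Mono a₂) : MonoSpan r₁.I r₂.O where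
  M := M
  left := a₁ ≫ r₁.i
  right := a₂ ≫ r₂.o
  mono_left := have := r₁.mono_i; mono_comp _ _
  mono_right := have := r₂.mono_o; mono_comp _ _

/-! ### Sequential independence of two consecutive rule applications -/

/-- The consecutive applications `X₀ ⇒ X₁ ⇒ X₂` along `r₁` and then `r₂` are sequentially
independent: the comatch of the first factors through the intermediate object of the second, by
`n₁`, and the match of the second through the intermediate object of the first, by `n₂`. -/
structure IsSequentialIndependence {T : RewritingType} {r₁ r₂ : LinearRule C} {X₀ X₁ X₂ : C}
    (δ₁ : DirectDerivation T r₁ X₀ X₁) (δ₂ : DirectDerivation T r₂ X₁ X₂)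
    (n₁ : r₁.O ⟶ δ₂.D) (n₂ : r₂.I ⟶ δ₁.D) : Prop where
  mono_n₁ : Mono n₁
  mono_n₂ : Mono n₂
  fac₁ : n₁ ≫ δ₂.d = δ₁.comatch
  fac₂ : n₂ ≫ δ₁.d' = δ₂.inMatch

/-- Sequential independence of two consecutive applications of linear rules. -/
def SequentiallyIndependent {T : RewritingType} {r₁ r₂ : LinearRule C} {X₀ X₁ X₂ : C}
    (δ₁ : DirectDerivation T r₁ X₀ X₁) (δ₂ : DirectDerivation T r₂ X₁ X₂) : Prop :=
  ∃ n₁ n₂, IsSequentialIndependence δ₁ δ₂ n₁ n₂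

/-- Sequential independence of two consecutive applications of rules with conditions: the
underlying applications of linear rules are sequentially independent, and the rules can be
applied in the opposite order at the same places, in such a way that the matches satisfy the
conditions of the rules. Here the match of `r₂` into `X₀` is `n₂ ≫ δ₁.d`, and the match of `r₁`
into the result of applying `r₂` comes from a factorization `n₁'` of the match of `r₁` into `X₀`
through the intermediate object. -/
def SequentiallyIndependentWithConditions {T : RewritingType} (R₁ R₂ : ConditionalRule C)
    {X₀ X₁ X₂ : C} (δ₁ : DirectDerivation T R₁.rule X₀ X₁)
    (δ₂ : DirectDerivation T R₂.rule X₁ X₂) : Prop :=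
  ∃ n₁ n₂, IsSequentialIndependence δ₁ δ₂ n₁ n₂ ∧
    ∃ (X₁' : C) (δ₂' : DirectDerivation T R₂.rule X₀ X₁')
      (δ₁' : DirectDerivation T R₁.rule X₁' X₂) (n₁' : R₁.rule.I ⟶ δ₂'.D),
      δ₂'.inMatch = n₂ ≫ δ₁.d ∧ n₁' ≫ δ₂'.d = δ₁.inMatch ∧ δ₁'.inMatch = n₁' ≫ δ₂'.d' ∧
      R₂.cond.Sat δ₂'.inMatch ∧ R₁.cond.Sat δ₁'.inMatch

/-- Every application of the linear rule `r₁` followed by `r₂`, of type `T`, whose underlying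
overlap (the pullback of `I₂ → X₁ ← O₁`) is `μ`, is sequentially independent. -/
def IndependentApplications (T : RewritingType) (r₁ r₂ : LinearRule C)
    (μ : MonoSpan r₂.I r₁.O) : Prop :=
  ∀ ⦃X₀ X₁ X₂ : C⦄ (δ₁ : DirectDerivation T r₁ X₀ X₁) (δ₂ : DirectDerivation T r₂ X₁ X₂),
    IsPullback μ.left μ.right δ₂.inMatch δ₁.comatch → SequentiallyIndependent δ₁ δ₂

/-- Every application of the rule with condition `R₁` followed by `R₂`, of type `T`, whose
underlying overlap is `μ`, is sequentially independent. -/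
def IndependentConditionalApplications (T : RewritingType) (R₁ R₂ : ConditionalRule C)
    (μ : MonoSpan R₂.rule.I R₁.rule.O) : Prop :=
  ∀ ⦃X₀ X₁ X₂ : C⦄ (δ₁ : DirectDerivation T R₁.rule X₀ X₁)
    (δ₂ : DirectDerivation T R₂.rule X₁ X₂),
    IsPullback μ.left μ.right δ₂.inMatch δ₁.comatch →
    R₁.cond.Sat δ₁.inMatch → R₂.cond.Sat δ₂.inMatch →
    SequentiallyIndependentWithConditions R₁ R₂ δ₁ δ₂

/-- The rules with conditions `R₁` and `R₂` are sequentially independent for rewriting of type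
`T`, with respect to the overlaps `μ₂₁` (`R₁` first) and `μ₁₂` (`R₂` first). -/
def RulesSequentiallyIndependent (T : RewritingType) (R₁ R₂ : ConditionalRule C)
    (μ₂₁ : MonoSpan R₂.rule.I R₁.rule.O) (μ₁₂ : MonoSpan R₁.rule.I R₂.rule.O) : Prop :=
  IndependentConditionalApplications T R₁ R₂ μ₂₁ ∧ IndependentConditionalApplications T R₂ R₁ μ₁₂

end Rewriting

/-!
All complements occurring in the theorem are final pullback complements: pushout complements of
monomorphisms in an adhesive category are final (`IsFinalPullbackComplement.of_isPushout`). Both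
types of rewriting are therefore governed by one universal property, and the factorizations that
express independence can be read off from it: once the overlap `M` of two rules lies in `K₁` and in
`K₂`, finality gives `O₁ → K̄₂` and `I₂ → K̄₁`, for compositions
(`Composition.seqIndependent`) and for arbitrary pairs of derivations
(`independentApplications_of_factorization`) alike.

Conversely, independence makes `M` factor through `K₁` and `K₂`. Restricting the pushout
`N = I₂ +_M O₁` to the subobjects `K̄₁`, `K̄₂` and `K₂₁` of `N` then shows `K̄₁ = I₂ +_M K₁`,
`K̄₂ = K₂ +_M O₁` and `K₂₁ = K₂ +_M K₁`, so that the composite rule is the amalgamation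
`O₁ +_M O₂ ← K₁ +_M K₂ → I₁ +_M I₂` (`Composition.IsIndependence.amalgamation`). This description
depends neither on the type of rewriting nor on the order of the two rules, which gives the
isomorphisms of composites and their compatibility with the embeddings of `I₁` and `I₂`.

For the conditions, `Condition.sat_shift` and `Condition.sat_trans` express satisfaction of shifted
and transported conditions by satisfaction along composites and comatches. A match `m` of the
composite rule that satisfies the composite condition thus comes from an application of the first
rule followed by one of the second, with matches satisfying their conditions
(`Composition.sat_condition_switch`). Here the second rule is applicable after the first because its
complement at the original object can be restricted to the intermediate object of the first
application and then extended along the pushout that creates the output. Switching the two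
applications by sequential independence produces exactly the matches that the condition of the
composite in the opposite order speaks about.
-/

namespace Rewriting

variable {C : Type u} [Category.{v} C]

/-! ### Pullbacks and pushouts in adhesive categories -/

theorem isPullback_comp_mono {P A B S S' : C} {x : P ⟶ A} {y : P ⟶ B} {f : A ⟶ S} {g : B ⟶ S}
    (h : IsPullback x y f g) (j : S ⟶ S') [Mono j] : IsPullback x y (f ≫ j) (g ≫ j) :=
  ⟨⟨by rw [← Category.assoc, h.w, Category.assoc]⟩,
    ⟨PullbackCone.IsLimit.mk _
      (fun s => h.lift s.fst s.snd (by
        rw [← cancel_mono j, Category.assoc, Category.assoc]; exact s.condition))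
      (fun s => h.lift_fst _ _ _) (fun s => h.lift_snd _ _ _)
      (fun s m h₁ h₂ => h.hom_ext (by rw [h₁, h.lift_fst]) (by rw [h₂, h.lift_snd]))⟩⟩

/-- Pushouts along monomorphisms are stable under pullback. -/
theorem isPushout_of_isPullback [Adhesive C] {W X Y Z W' X' Y' Z' : C}
    {f : W ⟶ X} {g : W ⟶ Y} {h : X ⟶ Z} {i : Y ⟶ Z} [Mono f] (H : IsPushout f g h i)
    {f' : W' ⟶ X'} {g' : W' ⟶ Y'} {h' : X' ⟶ Z'} {i' : Y' ⟶ Z'}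
    {αW : W' ⟶ W} {αX : X' ⟶ X} {αY : Y' ⟶ Y} {αZ : Z' ⟶ Z}
    (hf : IsPullback f' αW αX f) (hh : IsPullback h' αX αZ h) (hi : IsPullback i' αY αZ i)
    (w : f' ≫ h' = g' ≫ i') (wg : g' ≫ αY = αW ≫ g) : IsPushout f' g' h' i' := by
  have hg : IsPullback g' αW αY g := by
    refine IsPullback.of_right ?_ wg hi
    rw [← w, ← H.w]
    exact hf.paste_horiz hh
  exact (Adhesive.van_kampen H f' g' h' i' αW αX αY αZ hf hg hh.toCommSq hi.toCommSq ⟨w⟩).2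
    ⟨hh, hi⟩

/-- The union of two subobjects is effective: the pushout over their intersection embeds. -/
theorem mono_desc_of_isPullback [Adhesive C] {F A B E Z : C} {x : F ⟶ A} {y : F ⟶ B}
    {a : A ⟶ Z} {b : B ⟶ Z} [Mono a] [Mono b] (hF : IsPullback x y a b)
    {p : A ⟶ E} {r : B ⟶ E} (hE : IsPushout x y p r) {q : E ⟶ Z} (hp : p ≫ q = a)
    (hr : r ≫ q = b) : Mono q := by
  let e := hF.isoPullback
  have hE' : IsPushout (pullback.fst a b) (pullback.snd a b) p r := by
    refine IsPushout.of_iso hE e (Iso.refl _) (Iso.refl _) (Iso.refl _) ?_ ?_ ?_ ?_ <;>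
      simp [e]
  have hq : q = (hE'.isoIsPushout _ _ (IsPushout.of_hasPushout _ _)).hom ≫
      pushout.desc a b pullback.condition := by
    apply hE'.hom_ext
    · rw [hp, hE'.inl_isoIsPushout_hom_assoc, pushout.inl_desc]
    · rw [hr, hE'.inr_isoIsPushout_hom_assoc, pushout.inr_desc]
  rw [hq]
  infer_instance

/-! ### Final pullback complements -/

namespace IsFinalPullbackComplement

/-- When `d` is mono, only the existence of the lifts needs to be checked. -/
theorem of_mono {K I X D : C} {a : K ⟶ I} {c : I ⟶ X} {b : K ⟶ D} {d : D ⟶ X} [Mono d]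
    (h : IsPullback a b c d)
    (H : ∀ ⦃P Z : C⦄ (x : P ⟶ I) (y : P ⟶ Z) (z : Z ⟶ X), IsPullback x y c z →
      ∀ w : P ⟶ K, w ≫ a = x → ∃ w' : Z ⟶ D, w' ≫ d = z) :
    IsFinalPullbackComplement a c b d where
  isPullback := h
  final P Z x y z hP w hw := by
    obtain ⟨w', hw'⟩ := H x y z hP w hw
    refine ⟨w', ⟨hw', ?_⟩, fun t ht => ?_⟩
    · rw [← cancel_mono d, Category.assoc, hw', ← hP.w, ← hw, Category.assoc, Category.assoc, h.w]
    · rw [← cancel_mono d, hw', ht.1]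

/-- In an adhesive category, pushout complements of monomorphisms are final pullback
complements: pulling the pushout back along a test morphism that meets the input only in `K`
leaves nothing outside `D`. -/
theorem of_isPushout [HasPullbacks C] [Adhesive C] {K I X D : C} {a : K ⟶ I} {c : I ⟶ X}
    {b : K ⟶ D} {d : D ⟶ X} [Mono a] (H : IsPushout a b c d) :
    IsFinalPullbackComplement a c b d := by
  have : Mono d := Adhesive.mono_of_isPushout_of_mono_left H
  refine of_mono (Adhesive.isPullback_of_isPushout_of_mono_left H) fun P Z x y z hP w hw => ?_
  have hyz : y ≫ z = (w ≫ b) ≫ d := by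
    rw [← hP.w, ← hw, Category.assoc, Category.assoc, H.w]
  have hpo : IsPushout (𝟙 P) (pullback.lift y (w ≫ b) hyz) y (pullback.fst z d) :=
    isPushout_of_isPullback H (IsPullback.of_horiz_isIso_mono ⟨by simp [hw]⟩ : IsPullback _ w x _)
      hP.flip (IsPullback.of_hasPullback z d)
      (by rw [Category.id_comp, pullback.lift_fst]) (pullback.lift_snd _ _ _)
  refine ⟨hpo.desc (w ≫ b) (pullback.snd z d)
    (by rw [Category.id_comp, pullback.lift_snd]), hpo.hom_ext ?_ ?_⟩
  · simp [hyz]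
  · simp [pullback.condition]

theorem comp [HasPullbacks C] {K I X D X' D' : C} {a : K ⟶ I} {c : I ⟶ X} {b : K ⟶ D}
    {d : D ⟶ X} {c' : X ⟶ X'} {b' : D ⟶ D'} {d' : D' ⟶ X'} [Mono d]
    (h : IsFinalPullbackComplement a c b d) (h' : IsFinalPullbackComplement d c' b' d') :
    IsFinalPullbackComplement a (c ≫ c') (b ≫ b') d' := by
  have := h'.mono
  refine of_mono (h.isPullback.paste_vert h'.isPullback) fun P Z x y z hP w hw => ?_
  have hQ := IsPullback.of_hasPullback c' z
  have hxy : (x ≫ c) ≫ c' = y ≫ z := by rw [Category.assoc, hP.w]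
  have hP' : IsPullback x (hQ.lift (x ≫ c) y hxy) c (pullback.fst c' z) :=
    IsPullback.of_bot (by simpa using hP) (by simp) hQ
  obtain ⟨t, ⟨ht, -⟩, -⟩ := h.final _ _ _ hP' w hw
  obtain ⟨w', ⟨hw', -⟩, -⟩ := h'.final _ _ _ hQ t ht
  exact ⟨w', hw'⟩

theorem restrict [HasPullbacks C] {K I X D X' D' : C} {a : K ⟶ I} {c : I ⟶ X} {b : K ⟶ D}
    {d : D ⟶ X} [Mono a] (h : IsFinalPullbackComplement a c b d) {j : X' ⟶ X} [Mono j]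
    {c' : I ⟶ X'} (hc : c' ≫ j = c) {e : D' ⟶ D} {d' : D' ⟶ X'} (hD : IsPullback e d' d j)
    {b' : K ⟶ D'} (hb : b' ≫ e = b) (hb' : b' ≫ d' = a ≫ c') :
    IsFinalPullbackComplement a c' b' d' := by
  have := h.mono
  have : Mono d' := ⟨fun f g hfg => hD.hom_ext (by
    rw [← cancel_mono d, Category.assoc, Category.assoc, hD.w, reassoc_of% hfg]) hfg⟩
  refine of_mono (IsPullback.of_right (by rw [hb, hc]; exact h.isPullback.flip) hb' hD).flip
    fun P Z x y z hP w hw => ?_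
  obtain ⟨w', ⟨hw', -⟩, -⟩ := h.final x y (z ≫ j)
    (by rw [← hc]; exact isPullback_comp_mono hP j) w hw
  exact ⟨hD.lift w' z hw', by simp⟩

/-- If `q` extends the match `m` to the pushout of `i` along `k'`, the final pullback complement
of `m` is also one of `q`. -/
theorem exists_of_isPushout [HasPullbacks C] [Adhesive C] {K I X D B D' : C} {i : K ⟶ I}
    {m : I ⟶ X} {k : K ⟶ D} {d : D ⟶ X} [Mono i] (h : IsFinalPullbackComplement i m k d)
    {k' : K ⟶ D'} {j₁ : I ⟶ B} {j₂ : D' ⟶ B} (H : IsPushout i k' j₁ j₂) {q : B ⟶ X} [Mono q]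
    (hq : j₁ ≫ q = m) :
    ∃ w : D' ⟶ D, w ≫ d = j₂ ≫ q ∧ k' ≫ w = k ∧ IsFinalPullbackComplement j₂ q w d := by
  have := h.mono
  have : Mono j₂ := Adhesive.mono_of_isPushout_of_mono_left H
  have hPB := Adhesive.isPullback_of_isPushout_of_mono_left H
  obtain ⟨w, ⟨hw, hw'⟩, -⟩ := h.final i k' (j₂ ≫ q)
    (by rw [← hq]; exact isPullback_comp_mono hPB q) (𝟙 K) (by simp)
  -- A map to `B` that lands in `D` lands in `D'`: it meets `I` only in `K`, so the finality of
  -- `D'` as a complement of `I` in `B` applies.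
  have key : ∀ ⦃P : C⦄ (s : P ⟶ B) (t : P ⟶ D), s ≫ q = t ≫ d → ∃ l : P ⟶ D', l ≫ j₂ = s := by
    intro P s t hst
    have hQ := IsPullback.of_hasPullback j₁ s
    have hK : pullback.fst j₁ s ≫ m = (pullback.snd j₁ s ≫ t) ≫ d := by
      rw [← hq, ← Category.assoc, hQ.w, Category.assoc, Category.assoc, hst]
    obtain ⟨l, ⟨hl, -⟩, -⟩ := (of_isPushout H).final _ _ _ hQ (h.isPullback.lift _ _ hK) (by simp)
    exact ⟨l, hl⟩
  refine ⟨w, hw, by simpa using hw', of_mono ⟨⟨hw.symm⟩, ⟨PullbackCone.IsLimit.mk _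
    (fun s => (key s.fst s.snd s.condition).choose)
    (fun s => (key s.fst s.snd s.condition).choose_spec) (fun s => ?_) (fun s l h₁ h₂ => ?_)⟩⟩
    fun P Z x y z hP t ht => ?_⟩
  · rw [← cancel_mono d, Category.assoc, hw, ← Category.assoc,
      (key s.fst s.snd s.condition).choose_spec, s.condition]
  · rw [← cancel_mono j₂, h₁, (key s.fst s.snd s.condition).choose_spec]
  · have hQ := IsPullback.of_hasPullback m z
    have hxy : (pullback.fst m z ≫ j₁) ≫ q = pullback.snd m z ≫ z := by
      rw [Category.assoc, hq, hQ.w]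
    have hl : pullback.fst m z ≫ j₁ = (hP.lift _ _ hxy ≫ t) ≫ j₂ := by
      rw [Category.assoc, ht, hP.lift_fst]
    obtain ⟨w', ⟨hw', -⟩, -⟩ := h.final _ _ _ hQ (hPB.lift _ _ hl) (by simp)
    exact ⟨w', hw'⟩

end IsFinalPullbackComplement

/-! ### Complements and derivations of both types -/

namespace RewritingType.IsComplement

variable {T : RewritingType}

theorem isFinalPullbackComplement [HasPullbacks C] [Adhesive C] {K I X D : C} {a : K ⟶ I}
    {c : I ⟶ X} {b : K ⟶ D} {d : D ⟶ X} [Mono a] (h : T.IsComplement a c b d) :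
    IsFinalPullbackComplement a c b d := by
  cases T with
  | DPO => exact .of_isPushout h
  | SqPO => exact h

theorem of_isPushout [HasPullbacks C] [Adhesive C] {K I X D : C} {a : K ⟶ I} {c : I ⟶ X}
    {b : K ⟶ D} {d : D ⟶ X} [Mono a] (h : IsPushout a b c d) : T.IsComplement a c b d := by
  cases T with
  | DPO => exact h
  | SqPO => exact .of_isPushout h

/-- Complements of either type restrict to any subobject `X'` of `X` that contains the match. -/
theorem restrict [HasPullbacks C] [Adhesive C] {K I X D X' D' : C} {a : K ⟶ I} {c : I ⟶ X}
    {b : K ⟶ D} {d : D ⟶ X} [Mono a] (h : T.IsComplement a c b d) {j : X' ⟶ X} [Mono j]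
    {c' : I ⟶ X'} (hc : c' ≫ j = c) {e : D' ⟶ D} {d' : D' ⟶ X'} (hD : IsPullback e d' d j)
    {b' : K ⟶ D'} (hb : b' ≫ e = b) (hb' : b' ≫ d' = a ≫ c') : T.IsComplement a c' b' d' := by
  cases T with
  | DPO =>
    exact isPushout_of_isPullback (h : IsPushout a b c d)
      (IsPullback.of_vert_isIso ⟨by simp⟩ : IsPullback a (𝟙 K) (𝟙 I) a)
      (IsPullback.of_vert_isIso_mono ⟨by simp [hc]⟩) hD.flip hb'.symm (by simp [hb])
  | SqPO => exact IsFinalPullbackComplement.restrict h hc hD hb hb'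

/-- Complements of either type extend along a pushout of the complement. -/
theorem extend [HasPullbacks C] [Adhesive C] {K I X D X' D' : C} {a : K ⟶ I} {c : I ⟶ X}
    {b : K ⟶ D} {d : D ⟶ X} [Mono d] (h : T.IsComplement a c b d) {c' : X ⟶ X'} {b' : D ⟶ D'}
    {d' : D' ⟶ X'} (H : IsPushout d b' c' d') : T.IsComplement a (c ≫ c') (b ≫ b') d' := by
  cases T with
  | DPO => exact IsPushout.paste_vert h H
  | SqPO => exact IsFinalPullbackComplement.comp h (.of_isPushout H)

end RewritingType.IsComplement

namespace DirectDerivation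

variable {T : RewritingType} {r : LinearRule C} {X Y : C}

theorem isFinalPullbackComplement [HasPullbacks C] [Adhesive C] (δ : DirectDerivation T r X Y) :
    IsFinalPullbackComplement r.i δ.inMatch δ.k δ.d :=
  have := r.mono_i
  RewritingType.IsComplement.isFinalPullbackComplement δ.isComplement

theorem mono_k [HasPullbacks C] [Adhesive C] (δ : DirectDerivation T r X Y) : Mono δ.k := by
  have := r.mono_i
  have := δ.mono_inMatch
  have : Mono (δ.k ≫ δ.d) := by
    rw [← δ.isFinalPullbackComplement.isPullback.w]; exact mono_comp _ _
  exact mono_of_mono δ.k δ.d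

theorem mono_comatch [HasPullbacks C] [Adhesive C] (δ : DirectDerivation T r X Y) :
    Mono δ.comatch :=
  have := δ.mono_k
  Adhesive.mono_of_isPushout_of_mono_right δ.isPushout

/-- The left square of a derivation is a final pullback complement as well. -/
theorem isFinalPullbackComplement_comatch [HasPullbacks C] [Adhesive C]
    (δ : DirectDerivation T r X Y) : IsFinalPullbackComplement r.o δ.comatch δ.k δ.d' :=
  have := r.mono_o
  .of_isPushout δ.isPushout

end DirectDerivation

theorem exists_directDerivation [Adhesive C] {T : RewritingType} (r : LinearRule C) {X D : C}
    {m : r.I ⟶ X} [Mono m] {k : r.K ⟶ D} {d : D ⟶ X} (h : T.IsComplement r.i m k d) :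
    ∃ (Y : C) (δ : DirectDerivation T r X Y), δ.inMatch = m :=
  have := r.mono_o
  ⟨_, ⟨m, _, D, k, d, _, inferInstance, h, IsPushout.of_hasPushout r.o k⟩, rfl⟩

/-- A derivation along `o, i` with match `m` extends to one along the derived rule `p, j₂`, for
any extension `q` of `m` to the input of the derived rule. -/
theorem exists_derivation_of_derived [HasPullbacks C] [Adhesive C] {O K I X D Y : C} {o : K ⟶ O}
    {i : K ⟶ I} {m : I ⟶ X} {k : K ⟶ D} {d : D ⟶ X} {m' : O ⟶ Y} {d' : D ⟶ Y} [Mono i]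
    (h : IsFinalPullbackComplement i m k d) (h' : IsPushout o k m' d')
    {A B D' : C} {k' : K ⟶ D'} {j₁ : I ⟶ A} {j₂ : D' ⟶ A} (H : IsPushout i k' j₁ j₂)
    {b : O ⟶ B} {p : D' ⟶ B} (H' : IsPushout o k' b p) {q : A ⟶ X} [Mono q] (hq : j₁ ≫ q = m) :
    ∃ (w : D' ⟶ D) (q' : B ⟶ Y), w ≫ d = j₂ ≫ q ∧ b ≫ q' = m' ∧ Mono q' ∧
      IsFinalPullbackComplement j₂ q w d ∧ IsPushout p w q' d' := by
  have : Mono j₂ := Adhesive.mono_of_isPushout_of_mono_left H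
  obtain ⟨w, hw, hk, hF⟩ := h.exists_of_isPushout H hq
  subst hk
  have : Mono w := by
    have : Mono (w ≫ d) := by rw [hw]; exact mono_comp _ _
    exact mono_of_mono w d
  have hpo := h'.of_top' H'
  exact ⟨w, _, hw, by simp, Adhesive.mono_of_isPushout_of_mono_right hpo, hF, hpo⟩

/-! ### Satisfaction of shifted and transported conditions -/

namespace Condition

theorem sat_and {X Y : C} (c c' : Condition X) (m : X ⟶ Y) :
    (c.and c').Sat m ↔ c.Sat m ∧ c'.Sat m := by
  simp [Condition.and, Sat, ULift.forall, and_comm]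

theorem sat_disj {X Y : C} {ι : Type (max u v)} (c : ι → Condition X) (m : X ⟶ Y) :
    (disj ι c).Sat m ↔ ∃ j, (c j).Sat m := by
  simp [disj, Sat]

theorem ShiftSpan.mono_e₂ [Adhesive C] {A B₁ B₂ : C} {a₁ : A ⟶ B₁} {a₂ : A ⟶ B₂}
    (s : ShiftSpan a₁ a₂) : Mono s.e₂ :=
  have := s.hasPushout
  have := s.mono_b₁
  Adhesive.mono_of_isPushout_of_mono_left (IsPushout.of_hasPushout s.b₁ s.b₂)

theorem ShiftSpan.isPushout [Adhesive C] {A B₁ B₂ : C} {a₁ : A ⟶ B₁} {a₂ : A ⟶ B₂}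
    (s : ShiftSpan a₁ a₂) : IsPushout s.b₁ s.b₂ s.e₁ s.e₂ :=
  have := s.hasPushout
  IsPushout.of_hasPushout s.b₁ s.b₂

theorem sat_shift [Adhesive C] {A : C} (c : Condition A) :
    ∀ {B Y : C} (a : A ⟶ B) (n : B ⟶ Y) [Mono n], (c.shift a).Sat n ↔ c.Sat (a ≫ n) := by
  induction c with
  | tt => intro B Y a n _; simp [shift, Sat]
  | neg c ih => intro B Y a n _; simp [shift, Sat, ih]
  | conj ι c ih => intro B Y a n _; simp [shift, Sat, ih]
  | @ex A B₂ a₂ ha₂ c ih =>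
    intro B Y a n _
    rw [shift, sat_disj]
    simp only [Sat]
    constructor
    · rintro ⟨s, q, hq, hn, hs⟩
      have := s.rep.mono_e₂
      refine ⟨s.rep.e₂ ≫ q, mono_comp _ _, ?_, (ih _ _).1 hs⟩
      have h₁ := s.rep.fac₁ =≫ (s.rep.e₁ ≫ q)
      have h₂ := s.rep.fac₂ =≫ (s.rep.e₂ ≫ q)
      rw [Category.assoc] at h₁ h₂
      rw [← hn, ← h₁, ← h₂, reassoc_of% s.rep.isPushout.w]
    · rintro ⟨q, hq, hn, hs⟩
      have hF := IsPullback.of_hasPullback n q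
      let t : ShiftSpan a a₂ :=
        { F := pullback n q
          b₁ := pullback.fst n q
          b₂ := pullback.snd n q
          f := pullback.lift a a₂ hn.symm
          mono_b₁ := inferInstance
          mono_b₂ := inferInstance
          fac₁ := pullback.lift_fst _ _ _
          fac₂ := pullback.lift_snd _ _ _ }
      -- The chosen representative of the class of the intersection of `B` and `B₂`.
      let s : ShiftIndex a a₂ := Quotient.mk _ t
      obtain ⟨e, he₁, he₂⟩ : (shiftSetoid a a₂).r s.rep t :=
        Quotient.mk_out (s := shiftSetoid a a₂) t
      have hP : IsPullback s.rep.b₁ s.rep.b₂ n q :=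
        hF.of_iso e.symm (Iso.refl _) (Iso.refl _) (Iso.refl _)
          (by rw [← he₁]; exact (Category.comp_id _).trans (e.inv_hom_id_assoc t.b₁).symm)
          (by rw [← he₂]; exact (Category.comp_id _).trans (e.inv_hom_id_assoc t.b₂).symm) (by simp) (by simp)
      have h₁ := s.rep.isPushout.inl_desc n q hP.w
      have h₂ := s.rep.isPushout.inr_desc n q hP.w
      have hm := mono_desc_of_isPullback hP s.rep.isPushout h₁ h₂
      exact ⟨s, _, hm, h₁, (ih _ _).2 (by rwa [h₂])⟩

/-- Transport of conditions along a derivation. It suffices to treat final pullback complements,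
since pushout complements of monomorphisms are final. -/
theorem sat_trans [HasPullbacks C] [Adhesive C] {O : C} (c : Condition O) :
    ∀ {K I X Y D : C} (o : K ⟶ O) (ho : Mono o) (i : K ⟶ I) (hi : Mono i) (m : I ⟶ X)
      (k : K ⟶ D) (d : D ⟶ X) (m' : O ⟶ Y) (d' : D ⟶ Y), Mono m →
      IsFinalPullbackComplement i m k d → IsPushout o k m' d' →
      ((c.trans o ho i hi).Sat m ↔ c.Sat m') := by
  induction c with
  | tt => intros; simp [trans, Sat]
  | neg c ih =>
    intro K I X Y D o ho i hi m k d m' d' hm h h'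
    simp only [trans, Sat]
    rw [ih o ho i hi m k d m' d' hm h h']
  | conj ι c ih =>
    intro K I X Y D o ho i hi m k d m' d' hm h h'
    simp only [trans, Sat]
    exact forall_congr' fun j => ih j o ho i hi m k d m' d' hm h h'
  | @ex O B b hb c ih =>
    intro K I X Y D o ho i hi m k d m' d' hm h h'
    have hd := h.mono
    have hd' : Mono d' := Adhesive.mono_of_isPushout_of_mono_left h'
    by_cases hPOC : Nonempty (POC o b)
    · rw [trans, dif_pos hPOC]
      set p := hPOC.some
      have hk := p.mono_k ho hb
      have H : IsPushout i p.k (pushoutInl i hi p.k) (pushoutInr i hi p.k) :=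
        have := hasPushout_of_mono i hi p.k
        IsPushout.of_hasPushout i p.k
      have hj := mono_pushoutInr i hi p.k
      constructor
      · rintro ⟨q, hq, hqm, hs⟩
        obtain ⟨w, q', -, hbq, hq', hF, hpo⟩ := exists_derivation_of_derived h h' H p.isPushout hqm
        exact ⟨q', hq', hbq, (ih _ _ _ _ _ _ _ _ _ hq hF hpo).1 hs⟩
      · rintro ⟨q', hq', hbq, hs⟩
        -- `p.D` lies in `D`, since it meets the output of the rule only in `K`.
        obtain ⟨w, ⟨hw, hw'⟩, -⟩ := (IsFinalPullbackComplement.of_isPushout h').final o p.k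
          (p.d ≫ q') (by
            rw [← hbq]
            exact isPullback_comp_mono
              (Adhesive.isPullback_of_isPushout_of_mono_left p.isPushout) q') (𝟙 K) (by simp)
        rw [Category.id_comp] at hw'
        have hpd := p.mono_d ho
        have : Mono w := by
          have : Mono (w ≫ d') := by rw [hw]; exact mono_comp _ _
          exact mono_of_mono w d'
        have hP : IsPullback i p.k m (w ≫ d) := by
          have h₁ : IsPullback p.k (𝟙 K) w k := IsPullback.of_vert_isIso_mono ⟨by simp [hw']⟩
          simpa using (h₁.paste_vert h.isPullback.flip).flip
        have e₁ := H.inl_desc m (w ≫ d) hP.w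
        have e₂ := H.inr_desc m (w ≫ d) hP.w
        have hq := mono_desc_of_isPullback hP H e₁ e₂
        obtain ⟨w₂, q₂, hw₂, hbq₂, -, hF, hpo⟩ :=
          exists_derivation_of_derived h h' H p.isPushout e₁
        have hw₂' : w₂ = w := by rw [← cancel_mono d, hw₂, e₂]
        subst hw₂'
        have hq₂ : q₂ = q' := p.isPushout.hom_ext (by rw [hbq₂, hbq]) (by rw [hpo.w, hw])
        subst hq₂
        exact ⟨_, hq, e₁, (ih _ _ _ _ _ _ _ _ _ hq hF hpo).2 hs⟩
    · rw [trans, dif_neg hPOC]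
      refine iff_of_false (by simp [ff, Sat]) ?_
      rintro ⟨q', hq', hbq, -⟩
      -- Restricting the left square to `B` would give a pushout complement.
      have hD := IsPullback.of_hasPullback d' q'
      have hkb : k ≫ d' = (o ≫ b) ≫ q' := by rw [Category.assoc, hbq, h'.w]
      exact hPOC ⟨⟨_, _, _, RewritingType.IsComplement.restrict (T := .DPO) h' hbq hD
        (hD.lift_fst k (o ≫ b) hkb) (hD.lift_snd k (o ≫ b) hkb)⟩⟩

end Condition

/-! ### Amalgamated rules -/

/-- The rule `r` is the amalgamation `O₁ +_M O₂ ← K₁ +_M K₂ → I₁ +_M I₂` of the rules `r₁` and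
`r₂` along a common part `M` of `K₁` and `K₂`, which both of them preserve. -/
structure Amalgamation {r₁ r₂ : LinearRule C} {M : C} (a₁ : M ⟶ r₁.K) (a₂ : M ⟶ r₂.K)
    (r : LinearRule C) where
  O₁ : r₁.O ⟶ r.O
  O₂ : r₂.O ⟶ r.O
  K₁ : r₁.K ⟶ r.K
  K₂ : r₂.K ⟶ r.K
  I₁ : r₁.I ⟶ r.I
  I₂ : r₂.I ⟶ r.I
  isPushout_O : IsPushout (a₁ ≫ r₁.o) (a₂ ≫ r₂.o) O₁ O₂
  isPushout_K : IsPushout a₁ a₂ K₁ K₂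
  isPushout_I : IsPushout (a₁ ≫ r₁.i) (a₂ ≫ r₂.i) I₁ I₂
  o₁ : K₁ ≫ r.o = r₁.o ≫ O₁
  o₂ : K₂ ≫ r.o = r₂.o ≫ O₂
  i₁ : K₁ ≫ r.i = r₁.i ≫ I₁
  i₂ : K₂ ≫ r.i = r₂.i ≫ I₂

namespace Amalgamation

variable {r₁ r₂ : LinearRule C} {M : C} {a₁ : M ⟶ r₁.K} {a₂ : M ⟶ r₂.K} {r s : LinearRule C}

def symm (A : Amalgamation a₁ a₂ r) : Amalgamation a₂ a₁ r where
  O₁ := A.O₂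
  O₂ := A.O₁
  K₁ := A.K₂
  K₂ := A.K₁
  I₁ := A.I₂
  I₂ := A.I₁
  isPushout_O := A.isPushout_O.flip
  isPushout_K := A.isPushout_K.flip
  isPushout_I := A.isPushout_I.flip
  o₁ := A.o₂
  o₂ := A.o₁
  i₁ := A.i₂
  i₂ := A.i₁

/-- Two amalgamations of the same rules are isomorphic. -/
noncomputable def iso (A : Amalgamation a₁ a₂ r) (B : Amalgamation a₁ a₂ s) : r.Iso s where
  isoO := A.isPushout_O.isoIsPushout _ _ B.isPushout_O
  isoK := A.isPushout_K.isoIsPushout _ _ B.isPushout_K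
  isoI := A.isPushout_I.isoIsPushout _ _ B.isPushout_I
  comm_o := by
    apply A.isPushout_K.hom_ext
    · rw [reassoc_of% A.o₁]; simp [B.o₁]
    · rw [reassoc_of% A.o₂]; simp [B.o₂]
  comm_i := by
    apply A.isPushout_K.hom_ext
    · rw [reassoc_of% A.i₁]; simp [B.i₁]
    · rw [reassoc_of% A.i₂]; simp [B.i₂]

theorem I₁_iso (A : Amalgamation a₁ a₂ r) (B : Amalgamation a₁ a₂ s) :
    A.I₁ ≫ (A.iso B).isoI.hom = B.I₁ := by
  simp [iso]

theorem I₂_iso (A : Amalgamation a₁ a₂ r) (B : Amalgamation a₁ a₂ s) :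
    A.I₂ ≫ (A.iso B).isoI.hom = B.I₂ := by
  simp [iso]

end Amalgamation

/-! ### Compositions along independent overlaps -/

namespace Composition

variable {T : RewritingType} {r₂ r₁ : LinearRule C} {μ : MonoSpan r₂.I r₁.O}

theorem mono_p₁ [HasPullbacks C] [Adhesive C] (D : Composition T r₂ r₁ μ) : Mono D.p₁ := by
  have := D.δ₂.mono_d
  exact ⟨fun f g h => D.isPullback.hom_ext (by
    rw [← cancel_mono D.δ₂.d, Category.assoc, Category.assoc, D.isPullback.w, reassoc_of% h]) h⟩

theorem isPullback_overlap [Adhesive C] (D : Composition T r₂ r₁ μ) :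
    IsPullback μ.left μ.right D.δ₂.inMatch D.δ₁.comatch :=
  have := μ.mono_left
  Adhesive.isPullback_of_isPushout_of_mono_left D.isPushout

/-- The pullback of `I₂ → K̄₁ ← K₁` is the overlap of `I₂` and `O₁` in `N`, since `K₁` is the
pullback of `O₁` and `K̄₁`. -/
theorem isPullback_of_isPullback_left [Adhesive C] (D : Composition T r₂ r₁ μ)
    {v : r₂.I ⟶ D.δ₁.D} (hv : v ≫ D.δ₁.d' = D.δ₂.inMatch) {M : C} {p : M ⟶ r₂.I} {q : M ⟶ r₁.K}
    (h : IsPullback p q v D.δ₁.k) : IsPullback p (q ≫ r₁.o) D.δ₂.inMatch D.δ₁.comatch := by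
  have := r₁.mono_o
  rw [← hv]
  exact h.paste_vert (Adhesive.isPullback_of_isPushout_of_mono_left D.δ₁.isPushout).flip

theorem isPullback_of_isPullback_right [HasPullbacks C] [Adhesive C] (D : Composition T r₂ r₁ μ)
    {u : r₁.O ⟶ D.δ₂.D} (hu : u ≫ D.δ₂.d = D.δ₁.comatch) {M : C} {p : M ⟶ r₂.K} {q : M ⟶ r₁.O}
    (h : IsPullback p q D.δ₂.k u) : IsPullback (p ≫ r₂.i) q D.δ₂.inMatch D.δ₁.comatch := by
  rw [← hu]
  exact h.paste_horiz D.δ₂.isFinalPullbackComplement.isPullback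

/-- If the overlap lies in `K₁` and in `K₂`, then finality of the complements gives the
factorizations through `K̄₁` and `K̄₂`. -/
theorem seqIndependent [HasPullbacks C] [Adhesive C] (D : Composition T r₂ r₁ μ)
    {a₁ : μ.M ⟶ r₁.K} {a₂ : μ.M ⟶ r₂.K} (h₁ : a₁ ≫ r₁.o = μ.right) (h₂ : a₂ ≫ r₂.i = μ.left) :
    D.SeqIndependent := by
  obtain ⟨u, ⟨hu, -⟩, -⟩ := D.δ₂.isFinalPullbackComplement.final _ _ _ D.isPullback_overlap a₂ h₂
  obtain ⟨v, ⟨hv, -⟩, -⟩ := D.δ₁.isFinalPullbackComplement_comatch.final _ _ _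
    D.isPullback_overlap.flip a₁ h₁
  refine ⟨u, v, ?_, ?_, hu, hv⟩
  · have := D.δ₁.mono_comatch
    rw [← hu] at this
    exact mono_of_mono u D.δ₂.d
  · have := D.δ₂.mono_inMatch
    rw [← hv] at this
    exact mono_of_mono v D.δ₁.d'

/-- If the overlap lies in `K₁` and in `K₂`, a composition exists: the intermediate objects are
`K̄₂ = K₂ +_M O₁` and `K̄₁ = I₂ +_M K₁`. -/
theorem nonempty_of_factorization [HasPullbacks C] [Adhesive C] (T : RewritingType)
    {a₁ : μ.M ⟶ r₁.K} {a₂ : μ.M ⟶ r₂.K} (h₁ : a₁ ≫ r₁.o = μ.right) (h₂ : a₂ ≫ r₂.i = μ.left) :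
    Nonempty (Composition T r₂ r₁ μ) := by
  have := μ.mono_left
  have := μ.mono_right
  have := r₁.mono_o
  have := r₁.mono_i
  have := r₂.mono_o
  have := r₂.mono_i
  have : Mono a₂ := by
    have : Mono (a₂ ≫ r₂.i) := h₂ ▸ μ.mono_left
    exact mono_of_mono a₂ r₂.i
  have hN := IsPushout.of_hasPushout μ.left μ.right
  have hD₂ := IsPushout.of_hasPushout a₂ μ.right
  have hD₁ := IsPushout.of_hasPushout μ.left a₁
  have hN₂ : IsPushout (a₂ ≫ r₂.i) μ.right (pushout.inl μ.left μ.right)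
    (pushout.inr μ.left μ.right) := by rw [h₂]; exact hN
  have hN₁ : IsPushout μ.left (a₁ ≫ r₁.o) (pushout.inl μ.left μ.right)
    (pushout.inr μ.left μ.right) := by rw [h₁]; exact hN
  have H₂ := hN₂.of_left' hD₂
  have H₁ := hN₁.of_top' hD₁
  have hI₁ := IsPushout.of_hasPushout r₁.i (pushout.inr μ.left a₁)
  have mN₂ : Mono (pushout.inl μ.left μ.right) := Adhesive.mono_of_isPushout_of_mono_right hN
  have mk₁ : Mono (pushout.inr μ.left a₁) := Adhesive.mono_of_isPushout_of_mono_left hD₁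
  exact ⟨_, _, _,
    ⟨_, _, _, _, _, _, mN₂, .of_isPushout H₂, IsPushout.of_hasPushout r₂.o _⟩,
    ⟨_, _, _, _, _, _, Adhesive.mono_of_isPushout_of_mono_right hI₁, hI₁, H₁.flip⟩,
    hN, _, _, _, IsPullback.of_hasPullback _ _⟩

section Amalgamation

variable [Adhesive C] {D : Composition T r₂ r₁ μ} {u : r₁.O ⟶ D.δ₂.D}
  {v : r₂.I ⟶ D.δ₁.D} {a₁ : μ.M ⟶ r₁.K} {a₂ : μ.M ⟶ r₂.K}

theorem IsIndependence.isPullback_left (h : D.IsIndependence u v) (h₁ : a₁ ≫ r₁.o = μ.right) :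
    IsPullback μ.left a₁ v D.δ₁.k := by
  have := r₁.mono_o
  refine IsPullback.of_bot ?_ ?_
    (Adhesive.isPullback_of_isPushout_of_mono_left D.δ₁.isPushout).flip
  · rw [h₁, h.fac_v]
    exact D.isPullback_overlap
  · have := D.δ₁.mono_d'
    rw [← cancel_mono D.δ₁.d', Category.assoc, Category.assoc, h.fac_v, ← D.δ₁.isPushout.w,
      reassoc_of% h₁, D.isPushout.w]

theorem IsIndependence.isPullback_right [HasPullbacks C] (h : D.IsIndependence u v) (h₂ : a₂ ≫ r₂.i = μ.left) :
    IsPullback a₂ μ.right D.δ₂.k u := by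
  refine IsPullback.of_right ?_ ?_ D.δ₂.isFinalPullbackComplement.isPullback
  · rw [h₂, h.fac_u]
    exact D.isPullback_overlap
  · have := D.δ₂.mono_d
    rw [← cancel_mono D.δ₂.d, Category.assoc, Category.assoc, h.fac_u,
      ← D.δ₂.isFinalPullbackComplement.isPullback.w, reassoc_of% h₂, D.isPushout.w]

/-- `K̄₁ = I₂ +_M K₁`, by restricting `N = I₂ +_M O₁` to `K̄₁`. -/
theorem IsIndependence.isPushout_left [HasPullbacks C] (h : D.IsIndependence u v) (h₁ : a₁ ≫ r₁.o = μ.right) :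
    IsPushout μ.left a₁ v D.δ₁.k := by
  have := r₁.mono_o
  have := μ.mono_left
  have := D.δ₁.mono_d'
  exact isPushout_of_isPullback D.isPushout
    (IsPullback.of_vert_isIso ⟨by simp⟩ : IsPullback μ.left (𝟙 _) (𝟙 _) μ.left)
    (IsPullback.of_vert_isIso_mono ⟨by simp [h.fac_v]⟩)
    (Adhesive.isPullback_of_isPushout_of_mono_left D.δ₁.isPushout).flip
    (h.isPullback_left h₁).w (by simp [h₁])

/-- `K̄₂ = K₂ +_M O₁`, by restricting `N = I₂ +_M O₁` to `K̄₂`. -/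
theorem IsIndependence.isPushout_right [HasPullbacks C] (h : D.IsIndependence u v) (h₂ : a₂ ≫ r₂.i = μ.left) :
    IsPushout a₂ μ.right D.δ₂.k u := by
  have := r₂.mono_i
  have := μ.mono_left
  have := D.δ₂.mono_d
  exact isPushout_of_isPullback D.isPushout
    (IsPullback.of_horiz_isIso_mono ⟨by simp [h₂]⟩ :
      IsPullback (𝟙 _) a₂ μ.left r₂.i).flip
    D.δ₂.isFinalPullbackComplement.isPullback.flip
    (IsPullback.of_vert_isIso_mono ⟨by simp [h.fac_u]⟩ : IsPullback u (𝟙 _) D.δ₂.d _)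
    (h.isPullback_right h₂).w (by simp)

theorem IsIndependence.isPullback_lift [HasPullbacks C] (h : D.IsIndependence u v) :
    IsPullback (D.isPullback.lift D.δ₂.k (r₂.i ≫ v) (by
      rw [Category.assoc, h.fac_v, D.δ₂.isFinalPullbackComplement.isPullback.w])) r₂.i D.p₁ v := by
  refine IsPullback.of_right ?_ (D.isPullback.lift_snd _ _ _) D.isPullback
  rw [D.isPullback.lift_fst, h.fac_v]
  exact D.δ₂.isFinalPullbackComplement.isPullback.flip

/-- The composite along an independent overlap is the amalgamation of the two rules. -/
noncomputable def IsIndependence.amalgamation [HasPullbacks C] (h : D.IsIndependence u v)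
    (h₁ : a₁ ≫ r₁.o = μ.right) (h₂ : a₂ ≫ r₂.i = μ.left) :
    Amalgamation a₁ a₂ D.composite :=
  have hk₁ : (r₁.o ≫ u) ≫ D.δ₂.d = D.δ₁.k ≫ D.δ₁.d' := by
    rw [Category.assoc, h.fac_u, D.δ₁.isPushout.w]
  have hk₂ : D.δ₂.k ≫ D.δ₂.d = (r₂.i ≫ v) ≫ D.δ₁.d' := by
    rw [Category.assoc, h.fac_v, D.δ₂.isFinalPullbackComplement.isPullback.w]
  { O₁ := u ≫ D.δ₂.d'
    O₂ := D.δ₂.comatch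
    K₁ := D.isPullback.lift (r₁.o ≫ u) D.δ₁.k hk₁
    K₂ := D.isPullback.lift D.δ₂.k (r₂.i ≫ v) hk₂
    I₁ := D.δ₁.inMatch
    I₂ := v ≫ D.δ₁.d
    isPushout_O := by
      rw [h₁]
      exact (h.isPushout_right h₂).flip.paste_vert D.δ₂.isPushout.flip
    isPushout_K := by
      have := D.mono_p₁
      have := r₂.mono_i
      have := μ.mono_left
      refine (isPushout_of_isPullback (h.isPushout_left h₁)
        (IsPullback.of_horiz_isIso_mono ⟨by simp [h₂]⟩ : IsPullback (𝟙 _) a₂ μ.left r₂.i).flip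
        h.isPullback_lift
        (IsPullback.of_vert_isIso_mono ⟨by simp⟩ : IsPullback _ (𝟙 _) D.p₁ D.δ₁.k)
        ?_ (by simp)).flip
      apply D.isPullback.hom_ext
      · simp [(h.isPushout_right h₂).w, reassoc_of% h₁]
      · simp [(h.isPushout_left h₁).w, reassoc_of% h₂]
    isPushout_I := by
      rw [h₂]
      exact (h.isPushout_left h₁).flip.paste_horiz
        (show IsPushout r₁.i D.δ₁.k D.δ₁.inMatch D.δ₁.d from D.δ₁.isComplement)
    o₁ := by simp [composite]
    o₂ := by simp [composite, D.δ₂.isPushout.w]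
    i₁ := by
      have : IsPushout r₁.i D.δ₁.k D.δ₁.inMatch D.δ₁.d := D.δ₁.isComplement
      simp [composite, this.w]
    i₂ := by simp [composite] }

end Amalgamation

end Composition

/-! ### Consecutive applications -/

/-- If the overlap of two consecutive applications lies in `K₁` and in `K₂`, then finality of the
complements makes the applications sequentially independent. -/
theorem independentApplications_of_factorization [HasPullbacks C] [Adhesive C]
    (T : RewritingType) {r₁ r₂ : LinearRule C} {μ : MonoSpan r₂.I r₁.O} {a₁ : μ.M ⟶ r₁.K}
    {a₂ : μ.M ⟶ r₂.K} (h₁ : a₁ ≫ r₁.o = μ.right) (h₂ : a₂ ≫ r₂.i = μ.left) :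
    IndependentApplications T r₁ r₂ μ := by
  intro X₀ X₁ X₂ δ₁ δ₂ hP
  obtain ⟨n₁, ⟨hn₁, -⟩, -⟩ := δ₂.isFinalPullbackComplement.final _ _ _ hP a₂ h₂
  obtain ⟨n₂, ⟨hn₂, -⟩, -⟩ := δ₁.isFinalPullbackComplement_comatch.final _ _ _ hP.flip a₁ h₁
  refine ⟨n₁, n₂, ?_, ?_, hn₁, hn₂⟩
  · have := δ₁.mono_comatch
    rw [← hn₁] at this
    exact mono_of_mono n₁ δ₂.d
  · have := δ₂.mono_inMatch
    rw [← hn₂] at this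
    exact mono_of_mono n₂ δ₁.d'

theorem IsAdmissibleMatch.mono {T : RewritingType} {r : LinearRule C} {X : C} {m : r.I ⟶ X}
    (h : IsAdmissibleMatch T r m) : Mono m := by
  obtain ⟨Y, δ, rfl⟩ := h
  exact δ.mono_inMatch

theorem HasFinalPullbackComplements.isAdmissibleMatch [Adhesive C]
    (h : HasFinalPullbackComplements C) (r : LinearRule C) {X : C} (m : r.I ⟶ X) [Mono m] :
    IsAdmissibleMatch .SqPO r m := by
  obtain ⟨_, _, _, hc⟩ := h r.i m r.mono_i inferInstance
  exact exists_directDerivation (T := .SqPO) r hc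

/-- A DPO-admissible match of a composite rule restricts to one of the rule applied first. -/
theorem Composition.isAdmissibleMatch_of_composite [HasPullbacks C] [Adhesive C]
    {T : RewritingType} {r₂ r₁ : LinearRule C} {μ : MonoSpan r₂.I r₁.O}
    (D : Composition T r₂ r₁ μ) {X : C} {m : D.I₂₁ ⟶ X}
    (h : IsAdmissibleMatch .DPO D.composite m) :
    IsAdmissibleMatch .DPO r₁ (D.δ₁.inMatch ≫ m) := by
  have : Mono m := h.mono
  obtain ⟨Y, δ, hδm⟩ := h
  have := D.δ₁.mono_inMatch
  have := D.mono_p₁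
  let k : D.K₂₁ ⟶ δ.D := δ.k
  have hδ : IsPushout (D.p₁ ≫ D.δ₁.d) k m δ.d := hδm ▸ δ.isComplement
  have hD : IsPushout r₁.i D.δ₁.k D.δ₁.inMatch D.δ₁.d := D.δ₁.isComplement
  have hE : IsPushout D.p₁ k (pushout.inl D.p₁ k) (pushout.inr D.p₁ k) :=
    IsPushout.of_hasPushout _ _
  exact exists_directDerivation (T := .DPO) r₁ (hD.paste_vert (hδ.of_left' hE))

theorem IsAdmissibleMatch.of_iso {r s : LinearRule C} (e : r.Iso s) {X : C} {m : r.I ⟶ X}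
    (h : IsAdmissibleMatch .DPO r m) : IsAdmissibleMatch .DPO s (e.isoI.inv ≫ m) := by
  obtain ⟨Y, δ, rfl⟩ := h
  have := δ.mono_inMatch
  have hδ : IsPushout r.i δ.k δ.inMatch δ.d := δ.isComplement
  refine ⟨Y, ⟨_, e.isoO.inv ≫ δ.comatch, δ.D, e.isoK.inv ≫ δ.k, δ.d, δ.d', mono_comp _ _,
    ?_, ?_⟩, rfl⟩
  · exact hδ.of_iso e.isoK e.isoI (Iso.refl _) (Iso.refl _) e.comm_i (by simp) (by simp) (by simp)
  · exact δ.isPushout.of_iso e.isoK e.isoO (Iso.refl _) (Iso.refl _) e.comm_o (by simp) (by simp)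
      (by simp)

/-! ### The composite conditions -/

/-- A match of the composite rule that satisfies the composite condition splits into an
application of `R₁` followed by one of `R₂` with overlap `μ₂₁`. If these are sequentially
independent, switching them yields applications of `R₂` and then `R₁`, and hence the condition
of the composite in the opposite order. -/
theorem Composition.sat_condition_switch [HasPullbacks C] [Adhesive C] {T : RewritingType}
    {R₁ R₂ : ConditionalRule C} {μ₂₁ : MonoSpan R₂.rule.I R₁.rule.O}
    {μ₁₂ : MonoSpan R₁.rule.I R₂.rule.O} {D : Composition T R₂.rule R₁.rule μ₂₁}
    {D' : Composition T R₁.rule R₂.rule μ₁₂} {u : R₁.rule.O ⟶ D.δ₂.D} {v : R₂.rule.I ⟶ D.δ₁.D}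
    (h : D.IsIndependence u v) {u' : R₂.rule.O ⟶ D'.δ₂.D} {v' : R₁.rule.I ⟶ D'.δ₁.D}
    (h' : D'.IsIndependence u' v') (e : D.I₂₁ ≅ D'.I₂₁)
    (he₁ : D.δ₁.inMatch ≫ e.hom = v' ≫ D'.δ₁.d)
    (he₂ : (v ≫ D.δ₁.d) ≫ e.hom = D'.δ₁.inMatch)
    (ind : IndependentConditionalApplications T R₁ R₂ μ₂₁) {X : C} (m : D.I₂₁ ⟶ X) [Mono m]
    (adm₁ : IsAdmissibleMatch T R₁.rule (D.δ₁.inMatch ≫ m))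
    (adm₂ : IsAdmissibleMatch T R₂.rule ((v ≫ D.δ₁.d) ≫ m))
    (hs : (D.condition R₂.cond R₁.cond).Sat m) :
    (D'.condition R₁.cond R₂.cond).Sat (e.inv ≫ m) := by
  have := R₁.rule.mono_i
  have := R₁.rule.mono_o
  have := R₂.rule.mono_i
  have := D.δ₁.mono_d
  have := D.δ₁.mono_d'
  obtain ⟨hs₁, hs₂⟩ := (Condition.sat_and _ _ _).1 hs
  rw [Condition.sat_shift] at hs₁
  have he₁' : v' ≫ D'.δ₁.d ≫ e.inv ≫ m = D.δ₁.inMatch ≫ m := by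
    rw [← reassoc_of% he₁, e.hom_inv_id_assoc]
  have he₂' : D'.δ₁.inMatch ≫ e.inv ≫ m = (v ≫ D.δ₁.d) ≫ m := by
    rw [← he₂, Category.assoc (v ≫ D.δ₁.d), e.hom_inv_id_assoc]
  -- The application of `R₁`, and the induced comatch `n` of `N`.
  obtain ⟨X₁, ε₁, hε₁⟩ := adm₁
  have mε₁d := ε₁.mono_d
  have mε₁d' := ε₁.mono_d'
  obtain ⟨w₁, n, hw₁, hn, mn, hF₁, hpo₁⟩ := exists_derivation_of_derived
    ε₁.isFinalPullbackComplement ε₁.isPushout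
    (show IsPushout R₁.rule.i D.δ₁.k D.δ₁.inMatch D.δ₁.d from D.δ₁.isComplement)
    D.δ₁.isPushout hε₁.symm
  rw [Condition.sat_trans _ _ _ _ _ m w₁ ε₁.d n ε₁.d' inferInstance hF₁ hpo₁,
    Condition.sat_shift] at hs₂
  -- The complement of `R₂` at `X`, and its restriction to the intermediate object of `ε₁`.
  obtain ⟨Y, ε, hε⟩ := adm₂
  obtain ⟨w₂, -, hw₂, -, -, -, -⟩ := exists_derivation_of_derived
    ε.isFinalPullbackComplement ε.isPushout
    (show IsPushout R₂.rule.i D'.δ₁.k D'.δ₁.inMatch D'.δ₁.d from D'.δ₁.isComplement)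
    D'.δ₁.isPushout (q := e.inv ≫ m) (he₂'.trans hε.symm)
  have hE := IsPullback.of_hasPullback ε.d ε₁.d
  have hvw : (v ≫ w₁) ≫ ε₁.d = ε.inMatch := by
    rw [Category.assoc, hw₁, hε, Category.assoc]
  have hb : ε.k ≫ ε.d = (R₂.rule.i ≫ v ≫ w₁) ≫ ε₁.d := by
    rw [Category.assoc, hvw, ε.isFinalPullbackComplement.isPullback.w]
  have hR := RewritingType.IsComplement.restrict ε.isComplement hvw hE
    (hE.lift_fst _ _ hb) (hE.lift_snd _ _ hb)
  -- The restricted complement contains `K₁`, since the complement of `R₂` at `X` contains `I₁`.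
  have hg : (R₁.rule.i ≫ v' ≫ w₂) ≫ ε.d = ε₁.k ≫ ε₁.d := by
    rw [← ε₁.isFinalPullbackComplement.isPullback.w, Category.assoc, Category.assoc, hw₂, he₁', hε₁]
  have hG : IsPushout R₁.rule.o (hE.lift _ _ hg)
      (pushout.inl R₁.rule.o (hE.lift _ _ hg)) (pushout.inr R₁.rule.o (hE.lift _ _ hg)) :=
    IsPushout.of_hasPushout _ _
  have hε₁po : IsPushout R₁.rule.o (hE.lift _ _ hg ≫ pullback.snd ε.d ε₁.d) ε₁.comatch ε₁.d' := by
    rw [hE.lift_snd]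
    exact ε₁.isPushout
  have mE : Mono (pullback.snd ε.d ε₁.d) :=
    have := ε.mono_d
    inferInstance
  have hext := hR.extend (hε₁po.of_top' hG).flip
  have hmatch : (v ≫ w₁) ≫ ε₁.d' = D.δ₂.inMatch ≫ n := by
    rw [Category.assoc, ← hpo₁.w, ← h.fac_v, Category.assoc]
  rw [hmatch] at hext
  have := D.δ₂.mono_inMatch
  obtain ⟨X₂, ε₂, hε₂⟩ := exists_directDerivation R₂.rule hext
  -- Switching the two applications.
  obtain ⟨n₁, n₂, hind, X₁', δ₂', δ₁', n₁', hδ₂', hn₁', hδ₁', hsat₂, hsat₁⟩ := ind ε₁ ε₂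
    (by rw [hε₂, ← hn]; exact isPullback_comp_mono D.isPullback_overlap n)
    (by rwa [hε₁]) (by rwa [hε₂])
  have hn₂ : n₂ = v ≫ w₁ := by
    rw [← cancel_mono ε₁.d', hind.fac₂, hε₂, hmatch]
  have hm₂ : D'.δ₁.inMatch ≫ e.inv ≫ m = δ₂'.inMatch := by
    rw [he₂', hδ₂', hn₂, hvw, hε]
  have mδ₂'d := δ₂'.mono_d
  have := D'.δ₁.mono_d
  have := D'.δ₁.mono_d'
  obtain ⟨w₃, n₃, hw₃, hn₃, mn₃, hF₃, hpo₃⟩ := exists_derivation_of_derived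
    δ₂'.isFinalPullbackComplement δ₂'.isPushout
    (show IsPushout R₂.rule.i D'.δ₁.k D'.δ₁.inMatch D'.δ₁.d from D'.δ₁.isComplement)
    D'.δ₁.isPushout (q := e.inv ≫ m) hm₂
  have hw₃' : v' ≫ w₃ = n₁' := by
    rw [← cancel_mono δ₂'.d, Category.assoc, hw₃, he₁', hn₁', hε₁]
  refine (Condition.sat_and _ _ _).2 ⟨?_, ?_⟩
  · rwa [Condition.sat_shift, hm₂]
  · rw [Condition.sat_trans _ _ _ _ _ (e.inv ≫ m) w₃ δ₂'.d n₃ δ₂'.d' inferInstance hF₃ hpo₃,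
      Condition.sat_shift, ← h'.fac_v, Category.assoc, hpo₃.w, reassoc_of% hw₃', ← hδ₁']
    exact hsat₁

/-- If the rules with conditions are sequentially independent, the two composite conditions agree
on the matches at which both rules are applicable. -/
theorem Composition.sat_condition_iff [HasPullbacks C] [Adhesive C] {T : RewritingType}
    {R₁ R₂ : ConditionalRule C} {μ₂₁ : MonoSpan R₂.rule.I R₁.rule.O}
    {μ₁₂ : MonoSpan R₁.rule.I R₂.rule.O} {D : Composition T R₂.rule R₁.rule μ₂₁}
    {D' : Composition T R₁.rule R₂.rule μ₁₂} {u : R₁.rule.O ⟶ D.δ₂.D} {v : R₂.rule.I ⟶ D.δ₁.D}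
    (h : D.IsIndependence u v) {u' : R₂.rule.O ⟶ D'.δ₂.D} {v' : R₁.rule.I ⟶ D'.δ₁.D}
    (h' : D'.IsIndependence u' v') (e : D.I₂₁ ≅ D'.I₂₁)
    (he₁ : D.δ₁.inMatch ≫ e.hom = v' ≫ D'.δ₁.d)
    (he₂ : (v ≫ D.δ₁.d) ≫ e.hom = D'.δ₁.inMatch)
    (ind : RulesSequentiallyIndependent T R₁ R₂ μ₂₁ μ₁₂) {X : C} (m : D.I₂₁ ⟶ X) [Mono m]
    (adm₁ : IsAdmissibleMatch T R₁.rule (D.δ₁.inMatch ≫ m))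
    (adm₂ : IsAdmissibleMatch T R₂.rule ((v ≫ D.δ₁.d) ≫ m)) :
    (D.condition R₂.cond R₁.cond).Sat m ↔ (D'.condition R₁.cond R₂.cond).Sat (e.inv ≫ m) := by
  refine ⟨sat_condition_switch h h' e he₁ he₂ ind.1 m adm₁ adm₂, fun hs => ?_⟩
  have hs' := sat_condition_switch h' h e.symm
    (by simp [← he₂]) (by simp [← he₁]) ind.2 (e.inv ≫ m)
    (by rw [← he₂]; simpa using adm₂) (by rw [← he₁]; simpa using adm₁) hs
  simpa using hs'

end Rewriting

open Rewriting in
theorem mainTheorem4 {C : Type u} [Category.{v} C] [HasPullbacks C] [Adhesive C]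
    [HasInitial C] [HasStrictInitialObjects C]
    (hEM : HasEpiMonoFactorization C) (hfin : IsFinitary C)
    (T : RewritingType) (R₁ R₂ : ConditionalRule C) (μ₂₁ : MonoSpan R₂.rule.I R₁.rule.O)
    (D : Composition T R₂.rule R₁.rule μ₂₁)
    (hadm : ¬ (D.condition R₂.cond R₁.cond).Equiv Condition.ff)
    (u : R₁.rule.O ⟶ D.δ₂.D) (v : R₂.rule.I ⟶ D.δ₁.D) (huv : D.IsIndependence u v) :
    -- (i) the pullbacks of `I₂ → K̄₁ ← K₁` and of `K₂ → K̄₂ ← O₁` are isomorphic to `M₂₁`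
    (∀ (M' : C) (p : M' ⟶ R₂.rule.I) (q : M' ⟶ R₁.rule.K), IsPullback p q v D.δ₁.k →
      ∃ e : M' ≅ μ₂₁.M, e.hom ≫ μ₂₁.left = p ∧ e.hom ≫ μ₂₁.right = q ≫ R₁.rule.o) ∧
    (∀ (M' : C) (p : M' ⟶ R₂.rule.K) (q : M' ⟶ R₁.rule.O), IsPullback p q D.δ₂.k u →
      ∃ e : M' ≅ μ₂₁.M, e.hom ≫ μ₂₁.left = p ≫ R₂.rule.i ∧ e.hom ≫ μ₂₁.right = q) ∧
    -- whence monomorphisms `a₁ : M₂₁ → K₁` and `a₂ : M₂₁ → K₂`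
    ∃ (a₁ : μ₂₁.M ⟶ R₁.rule.K) (a₂ : μ₂₁.M ⟶ R₂.rule.K) (h₁ : Mono a₁) (h₂ : Mono a₂),
      a₁ ≫ R₁.rule.o = μ₂₁.right ∧ a₂ ≫ R₂.rule.i = μ₂₁.left ∧
      IsPullback μ₂₁.left a₁ v D.δ₁.k ∧ IsPullback a₂ μ₂₁.right D.δ₂.k u ∧
      -- (ii) `μ₁₂` is an admissible match of `r₁` into `r₂`, for DPO and for SqPO
      IsAdmissibleRuleMatch .DPO R₁.rule R₂.rule (switchSpan a₁ a₂ h₁ h₂) ∧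
      IsAdmissibleRuleMatch .SqPO R₁.rule R₂.rule (switchSpan a₁ a₂ h₁ h₂) ∧
      -- (iii) sequential independence with respect to `μ₁₂`, for both types of rewriting
      (∀ (T' : RewritingType) (D₁₂ : Composition T' R₁.rule R₂.rule (switchSpan a₁ a₂ h₁ h₂)),
        D₁₂.SeqIndependent) ∧
      (∀ T' : RewritingType,
        IndependentApplications T' R₂.rule R₁.rule (switchSpan a₁ a₂ h₁ h₂)) ∧
      -- (iii) the four composite rules exist and are isomorphic
      IsAdmissibleRuleMatch .DPO R₂.rule R₁.rule μ₂₁ ∧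
      IsAdmissibleRuleMatch .SqPO R₂.rule R₁.rule μ₂₁ ∧
      (∀ (S₂₁ : Composition .SqPO R₂.rule R₁.rule μ₂₁)
        (D₂₁ : Composition .DPO R₂.rule R₁.rule μ₂₁)
        (D₁₂ : Composition .DPO R₁.rule R₂.rule (switchSpan a₁ a₂ h₁ h₂))
        (S₁₂ : Composition .SqPO R₁.rule R₂.rule (switchSpan a₁ a₂ h₁ h₂)),
        Nonempty (S₂₁.composite.Iso D₂₁.composite) ∧
        Nonempty (D₂₁.composite.Iso D₁₂.composite) ∧
        Nonempty (D₁₂.composite.Iso S₁₂.composite)) ∧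
      -- (iv) the isomorphism of the composites can be taken compatible with the embeddings of
      -- `I₁` and `I₂`, and along it the composite conditions agree if the rules with conditions
      -- are sequentially independent
      (∀ (T' : RewritingType) (D₂₁ : Composition T' R₂.rule R₁.rule μ₂₁)
        (D₁₂ : Composition T' R₁.rule R₂.rule (switchSpan a₁ a₂ h₁ h₂)),
        ∃ (u₂₁ : R₁.rule.O ⟶ D₂₁.δ₂.D) (v₂₁ : R₂.rule.I ⟶ D₂₁.δ₁.D)
          (u₁₂ : R₂.rule.O ⟶ D₁₂.δ₂.D) (v₁₂ : R₁.rule.I ⟶ D₁₂.δ₁.D)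
          (φ : D₂₁.composite.Iso D₁₂.composite),
          D₂₁.IsIndependence u₂₁ v₂₁ ∧ D₁₂.IsIndependence u₁₂ v₁₂ ∧
          D₂₁.δ₁.inMatch ≫ φ.isoI.hom = v₁₂ ≫ D₁₂.δ₁.d ∧
          (v₂₁ ≫ D₂₁.δ₁.d) ≫ φ.isoI.hom = D₁₂.δ₁.inMatch ∧
          (RulesSequentiallyIndependent T' R₁ R₂ μ₂₁ (switchSpan a₁ a₂ h₁ h₂) →
            -- DPO: the conditions are equivalent on the matches admissible for the composite
            (T' = .DPO → Condition.EquivAlong φ.isoI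
              (fun _ m => IsAdmissibleMatch .DPO D₂₁.composite m)
              (D₂₁.condition R₂.cond R₁.cond) (D₁₂.condition R₁.cond R₂.cond)) ∧
            -- SqPO: they are equivalent wherever both rules are applicable; this is everywhere
            -- if `C` has final pullback complements
            (T' = .SqPO → Condition.EquivAlong φ.isoI
              (fun _ m => IsAdmissibleMatch .SqPO R₁.rule (D₂₁.δ₁.inMatch ≫ m) ∧
                IsAdmissibleMatch .SqPO R₂.rule ((v₂₁ ≫ D₂₁.δ₁.d) ≫ m))
              (D₂₁.condition R₂.cond R₁.cond) (D₁₂.condition R₁.cond R₂.cond)) ∧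
            (T' = .SqPO → HasFinalPullbackComplements C → Condition.EquivAlong φ.isoI
              (fun _ _ => True)
              (D₂₁.condition R₂.cond R₁.cond) (D₁₂.condition R₁.cond R₂.cond)))) := by
  have iso_of : ∀ {M' : C} {p : M' ⟶ R₂.rule.I} {q : M' ⟶ R₁.rule.O},
      IsPullback p q D.δ₂.inMatch D.δ₁.comatch →
      ∃ e : M' ≅ μ₂₁.M, e.hom ≫ μ₂₁.left = p ∧ e.hom ≫ μ₂₁.right = q := fun h =>
    ⟨h.isoIsPullback _ _ D.isPullback_overlap, by simp, by simp⟩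
  refine ⟨fun M' p q h => iso_of (D.isPullback_of_isPullback_left huv.fac_v h),
    fun M' p q h => iso_of (D.isPullback_of_isPullback_right huv.fac_u h), ?_⟩
  -- The overlap factors through `K₁` and `K₂`, as these are the pullbacks of `O₁` and `I₂`.
  obtain ⟨a₁, h₁⟩ : ∃ a₁ : μ₂₁.M ⟶ R₁.rule.K, a₁ ≫ R₁.rule.o = μ₂₁.right :=
    ⟨D.δ₁.isFinalPullbackComplement_comatch.isPullback.lift μ₂₁.right (μ₂₁.left ≫ v) (by
      rw [Category.assoc, huv.fac_v, D.isPushout.w]), by simp⟩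
  obtain ⟨a₂, h₂⟩ : ∃ a₂ : μ₂₁.M ⟶ R₂.rule.K, a₂ ≫ R₂.rule.i = μ₂₁.left :=
    ⟨D.δ₂.isFinalPullbackComplement.isPullback.lift μ₂₁.left (μ₂₁.right ≫ u) (by
      rw [Category.assoc, huv.fac_u, D.isPushout.w]), by simp⟩
  have m₁ : Mono a₁ := by
    have : Mono (a₁ ≫ R₁.rule.o) := h₁ ▸ μ₂₁.mono_right
    exact mono_of_mono a₁ R₁.rule.o
  have m₂ : Mono a₂ := by
    have : Mono (a₂ ≫ R₂.rule.i) := h₂ ▸ μ₂₁.mono_left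
    exact mono_of_mono a₂ R₂.rule.i
  -- The roles of `a₁` and `a₂` for the overlap `μ₁₂`.
  have h₁' : a₂ ≫ R₂.rule.o = (switchSpan a₁ a₂ m₁ m₂).right := rfl
  have h₂' : a₁ ≫ R₁.rule.i = (switchSpan a₁ a₂ m₁ m₂).left := rfl
  refine ⟨a₁, a₂, m₁, m₂, h₁, h₂, huv.isPullback_left h₁, huv.isPullback_right h₂,
    Composition.nonempty_of_factorization _ h₁' h₂',
    Composition.nonempty_of_factorization _ h₁' h₂',
    fun T' D₁₂ => D₁₂.seqIndependent h₁' h₂',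
    fun T' => independentApplications_of_factorization T' h₁' h₂',
    Composition.nonempty_of_factorization _ h₁ h₂,
    Composition.nonempty_of_factorization _ h₁ h₂,
    fun S₂₁ D₂₁ D₁₂ S₁₂ => ?_, fun T' D₂₁ D₁₂ => ?_⟩
  · obtain ⟨_, _, i₁⟩ := S₂₁.seqIndependent h₁ h₂
    obtain ⟨_, _, i₂⟩ := D₂₁.seqIndependent h₁ h₂
    obtain ⟨_, _, i₃⟩ := D₁₂.seqIndependent h₁' h₂'
    obtain ⟨_, _, i₄⟩ := S₁₂.seqIndependent h₁' h₂'
    exact ⟨⟨(i₁.amalgamation h₁ h₂).iso (i₂.amalgamation h₁ h₂)⟩,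
      ⟨(i₂.amalgamation h₁ h₂).iso (i₃.amalgamation h₁' h₂').symm⟩,
      ⟨(i₃.amalgamation h₁' h₂').iso (i₄.amalgamation h₁' h₂')⟩⟩
  · obtain ⟨u₂₁, v₂₁, i₂₁⟩ := D₂₁.seqIndependent h₁ h₂
    obtain ⟨u₁₂, v₁₂, i₁₂⟩ := D₁₂.seqIndependent h₁' h₂'
    let A := i₂₁.amalgamation h₁ h₂
    let B := (i₁₂.amalgamation h₁' h₂').symm
    let φ : D₂₁.composite.Iso D₁₂.composite := A.iso B
    let e : D₂₁.I₂₁ ≅ D₁₂.I₂₁ := φ.isoI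
    have he₁ : D₂₁.δ₁.inMatch ≫ e.hom = v₁₂ ≫ D₁₂.δ₁.d := A.I₁_iso B
    have he₂ : (v₂₁ ≫ D₂₁.δ₁.d) ≫ e.hom = D₁₂.δ₁.inMatch := A.I₂_iso B
    refine ⟨u₂₁, v₂₁, u₁₂, v₁₂, φ, i₂₁, i₁₂, he₁, he₂, fun ind => ?_⟩
    have agree : ∀ {X : C} (m : D₂₁.I₂₁ ⟶ X), Mono m →
        IsAdmissibleMatch T' R₁.rule (D₂₁.δ₁.inMatch ≫ m) →
        IsAdmissibleMatch T' R₂.rule ((v₂₁ ≫ D₂₁.δ₁.d) ≫ m) →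
        ((D₂₁.condition R₂.cond R₁.cond).Sat m ↔
          (D₁₂.condition R₁.cond R₂.cond).Sat (e.inv ≫ m)) :=
      fun m _ adm₁ adm₂ => Composition.sat_condition_iff i₂₁ i₁₂ e he₁ he₂ ind m adm₁ adm₂
    refine ⟨?_, ?_, ?_⟩
    · rintro rfl X (m : D₂₁.I₂₁ ⟶ X) hm adm
      have hm₂ : (v₂₁ ≫ D₂₁.δ₁.d) ≫ m = D₁₂.δ₁.inMatch ≫ e.inv ≫ m := by
        rw [← he₂, Category.assoc _ e.hom, e.hom_inv_id_assoc]
      refine agree m hm (D₂₁.isAdmissibleMatch_of_composite adm) ?_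
      rw [hm₂]
      exact D₁₂.isAdmissibleMatch_of_composite (adm.of_iso φ)
    · rintro rfl X m hm adm
      exact agree m hm adm.1 adm.2
    · rintro rfl hFPC X (m : D₂₁.I₂₁ ⟶ X) (hm : Mono m) -
      have := D₂₁.δ₁.mono_inMatch
      have := D₂₁.δ₁.mono_d
      have := i₂₁.mono_v
      exact agree m hm (hFPC.isAdmissibleMatch _ _) (hFPC.isAdmissibleMatch _ _)
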